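/- Let $K$ be a field of characteristic different from $2$ with an involution $a\mapsto\bar a$ (possibly the identity). For $f=\sum a_ix^i\in K[x]$ put $\bar f=\sum\bar a_ix^i$, and for a matrix $M=[m_{ij}]$ over $K$ put $M^*=[\bar m_{ji}]$. Let $\varepsilon\in\{1,-1\}$, with $\varepsilon=1$ if the involution is not the identity. A Frobenius block is the $n\times n$ matrix $$\Phi=\begin{bmatrix}0&&0&-c_n\\1&\ddots&&\vdots\\&\ddots&0&-c_2\\0&&1&-c_1\end{bmatrix}$$ whose characteristic polynomial $\chi_\Phi=x^n+c_1x^{n-1}+\dots+c_n$ is a positive integer power of a monic polynomial $p_\Phi$ that is irreducible over $K$. For each Frobenius block $\Phi$ for which there is a nonsingular matrix $M$ with $M=M^*$ and $M\Phi=(M\Phi)^*$, fix one such matrix and denote it by $\Phi_1$; if there is no such matrix, say that $\Phi_1$ does not exist. If $\Phi_1$ exists, then $\bar p_\Phi=p_\Phi$, so that $f(\omega)^\circ=\bar f(\omega)$ is an involution of the field $K[\omega]=K[x]/p_\Phi K[x]$. Let $F$ be a nondegenerate $\varepsilon$-Hermitian form on a finite-dimensional vector space $V$ over $K$ (semilinear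 in the first and linear in the second argument, $F(x,y)=\varepsilon\overline{F(y,x)}$), and let $A$ be a linear operator on $V$ that is selfadjoint: $F(x,Ay)=F(Ax,y)$ for all $x,y\in V$. Then there is a basis of $V$ in which the pair $(A,F)$ is given by a direct sum of pairs of matrices of the following types: (i) $\left(\begin{bmatrix}\Phi&0\\0&\Phi^*\end{bmatrix},\ \begin{bmatrix}0&\varepsilon I_n\\I_n&0\end{bmatrix}\right)$, where $\Phi$ is an $n\times n$ Frobenius block and, if $\varepsilon=1$, $\Phi_1$ does not exist; (ii) $A_\Phi^{f}=(\Phi,\ \Phi_1f(\Phi))$, where $\varepsilon=1$, $\Phi$ is a Frobenius block for which $\Phi_1$ exists, $0\ne f=\bar f\in K[x]$, and $\deg f<\deg p_\Phi$. The summands are determined exactly to the following extent: if $(A,F)$ is given in some basis by a direct sum $D$ of such pairs, then a direct sum $D'$ of such pairs also gives $(A,F)$ in some basis if and only if $D'$ is obtained from $D$, up to permutation of summands, by (i) replacing, in any summands of type (i), $\Phi$ by the Frobenius block $\Psi$ with $\chi_\Psi=\bar\chi_\Phi$; (ii) replacing, for each $\Phi$, the whole group $A_\Phi^{f_1}\oplus\dots\oplus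 A_\Phi^{f_s}$ of summands of type (ii) with this $\Phi$ by a group $A_\Phi^{g_1}\oplus\dots\oplus A_\Phi^{g_s}$ such that the Hermitian forms $$f_1(\omega)x_1^\circ x_1+\dots+f_s(\omega)x_s^\circ x_s,\qquad g_1(\omega)x_1^\circ x_1+\dots+g_s(\omega)x_s^\circ x_s$$ are equivalent over $K[\omega]$ with the involution $f(\omega)^\circ=\bar f(\omega)$. -/

import Mathlib

open scoped Matrix Polynomial

noncomputable section

namespace SelfadjointOperator

variable {K : Type*} [Field K]

/-- A label of a Frobenius block over `K`: a monic irreducible polynomial `p` and a positive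
exponent `m`; the characteristic polynomial of the block is `p ^ m`. -/
@[ext]
structure FrobeniusBlock (K : Type*) [Field K] where
  p : K[X]
  m : ℕ
  monic : p.Monic
  irreducible : Irreducible p
  pos : 0 < m

namespace FrobeniusBlock

/-- The polynomial `χ = p ^ m = x ^ n + c₁ x ^ (n - 1) + ⋯ + cₙ`. -/
def chi (Φ : FrobeniusBlock K) : K[X] := Φ.p ^ Φ.m

/-- The size `n` of the block. -/
def size (Φ : FrobeniusBlock K) : ℕ := Φ.chi.natDegree

/-- The Frobenius block itself: ones below the diagonal, last column `-cₙ, …, -c₁`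
(from top to bottom), zeros elsewhere. -/
def matrix (Φ : FrobeniusBlock K) : Matrix (Fin Φ.size) (Fin Φ.size) K :=
  Matrix.of fun i j =>
    if (j : ℕ) + 1 = Φ.size then -Φ.chi.coeff i else if (i : ℕ) = (j : ℕ) + 1 then 1 else 0

theorem chi_monic (Φ : FrobeniusBlock K) : Φ.chi.Monic := Φ.monic.pow Φ.m

/-- The characteristic polynomial of the block is `p ^ m`. -/
theorem charpoly_matrix (Φ : FrobeniusBlock K) : Φ.matrix.charpoly = Φ.chi := by
  have hmin : minpoly K (AdjoinRoot.powerBasis' Φ.chi_monic).gen = Φ.chi := by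
    rw [AdjoinRoot.powerBasis'_gen, AdjoinRoot.minpoly_root Φ.chi_monic.ne_zero,
      Φ.chi_monic.leadingCoeff]
    simp
  have h := charpoly_leftMulMatrix (AdjoinRoot.powerBasis' Φ.chi_monic)
  rw [hmin] at h
  rw [← h, PowerBasis.leftMulMatrix, PowerBasis.minpolyGen_eq, hmin]
  rfl

variable [StarRing K]

/-- `M` is a possible value of the matrix `Φ₁`: it is nonsingular, `M = M*` and
`M Φ = (M Φ)*`. -/
def IsPhiOne (Φ : FrobeniusBlock K) (M : Matrix (Fin Φ.size) (Fin Φ.size) K) : Prop :=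
  IsUnit M.det ∧ M = Mᴴ ∧ M * Φ.matrix = (M * Φ.matrix)ᴴ

/-- The matrix `Φ₁` exists. -/
def HasPhiOne (Φ : FrobeniusBlock K) : Prop :=
  ∃ M : Matrix (Fin Φ.size) (Fin Φ.size) K, Φ.IsPhiOne M

/-- If `Φ₁` exists, then `p` is fixed by the involution applied to its coefficients. This makes
the involution on `K[x]/(p)` below well defined. -/
theorem HasPhiOne.map_p {Φ : FrobeniusBlock K} (h : Φ.HasPhiOne) :
    Φ.p.map (starRingEnd K) = Φ.p := by
  obtain ⟨M, hdet, hM, hMΦ⟩ := h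
  have hchar : Φ.matrixᴴ.charpoly = Φ.chi.map (starRingEnd K) := by
    rw [← Φ.charpoly_matrix, ← Matrix.charpoly_map, ← Matrix.charpoly_transpose]
    rfl
  have hconj : Φ.matrixᴴ = M * Φ.matrix * M⁻¹ := by
    rw [hMΦ, Matrix.conjTranspose_mul, ← hM, Matrix.mul_assoc, Matrix.mul_nonsing_inv _ hdet,
      Matrix.mul_one]
  have hsim : Φ.matrixᴴ.charpoly = Φ.chi := by
    rw [hconj, ← Φ.charpoly_matrix, Matrix.mul_assoc, Matrix.charpoly_mul_comm, Matrix.mul_assoc,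
      Matrix.nonsing_inv_mul _ hdet, Matrix.mul_one]
  have hpow : (Φ.p.map (starRingEnd K)) ^ Φ.m = Φ.p ^ Φ.m := by
    rw [← Polynomial.map_pow]
    exact hchar.symm.trans hsim
  have hdvd : Φ.p ∣ Φ.p.map (starRingEnd K) :=
    Φ.irreducible.prime.dvd_of_dvd_pow (n := Φ.m)
      (hpow.symm ▸ dvd_pow_self Φ.p Φ.pos.ne')
  exact (Polynomial.eq_of_monic_of_dvd_of_natDegree_le Φ.monic (Φ.monic.map _) hdvd
    (Polynomial.natDegree_map _).le)

/-- The involution `f(ω)° = f̄(ω)` of the field `K[ω] = K[x]/(p)`, for `p` with `p̄ = p`. -/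
def involution (Φ : FrobeniusBlock K) (h : Φ.HasPhiOne) :
    AdjoinRoot Φ.p →+* AdjoinRoot Φ.p :=
  AdjoinRoot.map (starRingEnd K) Φ.p Φ.p (dvd_of_eq h.map_p.symm)

end FrobeniusBlock

/-- The diagonal Hermitian form `a₁ x₁° x₁ + ⋯ + aₛ xₛ° xₛ`, as a sesquilinear form on `Rˢ`,
where `x° = σ x`. -/
def diagForm {R : Type*} [CommRing R] (σ : R →+* R) (a : List R)
    (x y : Fin a.length → R) : R :=
  ∑ i, σ (x i) * a.get i * y i

/-- Equivalence over `R` of the diagonal Hermitian forms with coefficients `a` and `b`. -/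
def DiagFormEquiv {R : Type*} [CommRing R] (σ : R →+* R) (a b : List R) : Prop :=
  ∃ e : (Fin a.length → R) ≃ₗ[R] (Fin b.length → R),
    ∀ x y, diagForm σ b (e x) (e y) = diagForm σ a x y

/-- The two types of summands: `typeI Φ` stands for `(Φ ⊕ Φ*, [I ⧹ ε I])` and `typeII Φ f` for
`(Φ, Φ₁ f(Φ))`. -/
inductive Summand (K : Type*) [Field K] where
  | typeI (Φ : FrobeniusBlock K)
  | typeII (Φ : FrobeniusBlock K) (f : K[X])

namespace Summand

/-- The index type of the rows and columns of the matrices of a summand. -/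
def Index : Summand K → Type
  | typeI Φ => Fin Φ.size ⊕ Fin Φ.size
  | typeII Φ _ => Fin Φ.size

instance (S : Summand K) : Fintype S.Index :=
  match S with
  | typeI Φ => inferInstanceAs (Fintype (Fin Φ.size ⊕ Fin Φ.size))
  | typeII Φ _ => inferInstanceAs (Fintype (Fin Φ.size))

instance (S : Summand K) : DecidableEq S.Index :=
  match S with
  | typeI Φ => inferInstanceAs (DecidableEq (Fin Φ.size ⊕ Fin Φ.size))
  | typeII Φ _ => inferInstanceAs (DecidableEq (Fin Φ.size))

variable [StarRing K]

/-- The conditions on the summands, for a given `ε`. -/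
def Admissible (ε : K) : Summand K → Prop
  | typeI Φ => ε = 1 → ¬ Φ.HasPhiOne
  | typeII Φ f =>
      ε = 1 ∧ Φ.HasPhiOne ∧ f ≠ 0 ∧ f.map (starRingEnd K) = f ∧ f.degree < Φ.p.degree

/-- The matrix of the operator in a summand: `Φ ⊕ Φ*`, respectively `Φ`. -/
def opMatrix : (S : Summand K) → Matrix S.Index S.Index K
  | typeI Φ => (Matrix.fromBlocks Φ.matrix 0 0 Φ.matrixᴴ :
      Matrix (Fin Φ.size ⊕ Fin Φ.size) (Fin Φ.size ⊕ Fin Φ.size) K)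
  | typeII Φ _ => Φ.matrix

/-- The matrix of the form in a summand: `[I ⧹ ε I]`, that is `I` in the lower left corner and
`ε I` in the upper right corner, respectively `Φ₁ f(Φ)`, where `P` is the choice of the
matrices `Φ₁`. -/
def formMatrix (P : (Φ : FrobeniusBlock K) → Matrix (Fin Φ.size) (Fin Φ.size) K) (ε : K) :
    (S : Summand K) → Matrix S.Index S.Index K
  | typeI Φ => (Matrix.fromBlocks 0 (ε • 1) 1 0 :
      Matrix (Fin Φ.size ⊕ Fin Φ.size) (Fin Φ.size ⊕ Fin Φ.size) K)
  | typeII Φ f => P Φ * Polynomial.aeval Φ.matrix f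

end Summand

/-- The index type of the direct sum of a list of summands. -/
abbrev SumIndex (L : List (Summand K)) : Type := (i : Fin L.length) × (L.get i).Index

/-- The Frobenius blocks of the summands of type (i), with multiplicities. -/
def typeIBlocks (L : List (Summand K)) : Multiset (FrobeniusBlock K) :=
  (L.filterMap fun S => match S with
    | .typeI Φ => some Φ
    | .typeII _ _ => none : List (FrobeniusBlock K))

open Classical in
/-- The polynomials `f₁, …, fₛ` of the summands `(Φ, Φ₁ fᵢ(Φ))` with the given `Φ`. -/
def typeIIPolys (L : List (Summand K)) (Φ : FrobeniusBlock K) : List K[X] :=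
  L.filterMap fun S => match S with
    | .typeI _ => none
    | .typeII Ψ f => if Ψ = Φ then some f else none

variable [StarRing K]

/-- In some basis of `V`, the pair `(A, F)` (an operator and a sesquilinear form, semilinear in
the first argument) is given by the direct sum of the matrix pairs in the list `L`. -/
def IsGivenBy {V : Type*} [AddCommGroup V] [Module K V]
    (P : (Φ : FrobeniusBlock K) → Matrix (Fin Φ.size) (Fin Φ.size) K) (ε : K)
    (A : Module.End K V) (F : V →ₗ⋆[K] V →ₗ[K] K) (L : List (Summand K)) : Prop :=
  ∃ b : Module.Basis (SumIndex L) K V,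
    LinearMap.toMatrix b b A = Matrix.blockDiagonal' (fun i => (L.get i).opMatrix) ∧
    (Matrix.of fun i j => F (b i) (b j)) =
      Matrix.blockDiagonal' (fun i => (L.get i).formMatrix P ε)

/-- The extent to which the summands are determined, up to their order: a block `Φ` of type (i)
may be replaced by `Ψ` with `χ_Ψ = χ̄_Φ`, and the group of all summands of type (ii) with the same
`Φ` may be replaced by another such group, if the Hermitian forms `∑ fᵢ(ω) xᵢ° xᵢ` and `∑ gᵢ(ω) xᵢ° xᵢ` are
equivalent over `K[ω] = K[x]/(p_Φ)`. -/
def SameSummands (L L' : List (Summand K)) : Prop :=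
  Multiset.Rel (fun Φ Ψ => Ψ.chi = Φ.chi ∨ Ψ.chi = Φ.chi.map (starRingEnd K))
    (typeIBlocks L) (typeIBlocks L') ∧
  ∀ (Φ : FrobeniusBlock K) (h : Φ.HasPhiOne),
    DiagFormEquiv (Φ.involution h)
      ((typeIIPolys L Φ).map (AdjoinRoot.mk Φ.p)) ((typeIIPolys L' Φ).map (AdjoinRoot.mk Φ.p))

end SelfadjointOperator

end

/-! Matrices are traded for vectors. A type (ii) summand is a cyclic subspace K[A]v on which F is
determined by the functional c ↦ F(v, c(A)v). A type (i) summand is the sum of two cyclic isotropic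
subspaces, dual to each other. A choice of Φ₁ amounts to the functional `ell` on K[x]/(χ), g ↦ (Φ₁
g(Φ))₀₀. It commutes with conjugation, and a, b ↦ ell(ab) is nondegenerate. `isGivenBy_iff`
translates between matrix sums and orthogonal sums of such subspaces.

Existence. Let p^m be the exact power of an irreducible p in the minimal polynomial of A.
Nondegeneracy gives u, w killed by p^m and its conjugate with F(w, p(A)^(m-1) u) ≠ 0
(`exists_dual_vectors`). If ε = 1 and p̄ = p, polarization yields one vector v with F(v, p(A)^(m-1)
v) ≠ 0. The form on K[A]v is then c ↦ ell(ch) for some h = h̄ prime to p. Replacing v by a(A)v with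
ā = a replaces h by a²h, so Newton iteration, which needs 2 ≠ 0, reduces h modulo χ to its remainder
f modulo p (`exists_cyclicVector`). In the remaining cases u and w are isotropic and generate a type
(i) summand. The form is nondegenerate on the summand, so it splits off orthogonally, and induction
on dimension finishes (`exists_decomp`).

Invariance. Second differences of the ranks of p(A)^k count the cyclic summands K[x]/(p^m), which
determines the type (i) blocks up to conjugation (`Decomp.typeIBlocks_rel`). For type (ii), the form
F(u, p(A)^(m-1) v) on the kernel of p(A)^m, modulo its radical, depends only on (A, F). Read through
the functional induced by `ell` on K[ω], it is the diagonal form ∑ fᵢ(ω) xᵢ° xᵢ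
(`Decomp.exists_isLayerMap`, `IsLayerMap.diagFormEquiv`).

Converse. Conjugating a type (i) block only exchanges its two generators. If two diagonal forms are
equivalent, then in the space of the first group a vector representing the first coordinate of the
second form is lifted by the same Newton argument to a cyclic vector. It splits off, and the rest of
the form survives on its orthogonal complement (`IsLayerMap.exists_cyclicVector`,
`decomp_of_isLayerMap`). -/

noncomputable section

namespace SelfadjointOperator

open Polynomial

section Algebra

variable {K : Type*} [Field K]

/-! ### Cyclic subspaces -/

section Cyclic

variable {V : Type*} [AddCommGroup V] [Module K V]

/-- The cyclic subspace `K[A] v`. -/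
def cyc (A : Module.End K V) (v : V) : Submodule K V :=
  LinearMap.range ((LinearMap.applyₗ v) ∘ₗ (aeval A).toLinearMap : K[X] →ₗ[K] V)

theorem mem_cyc {A : Module.End K V} {v x : V} : x ∈ cyc A v ↔ ∃ c : K[X], aeval A c v = x := by
  simp [cyc, LinearMap.mem_range]

theorem aeval_mem_cyc (A : Module.End K V) (v : V) (c : K[X]) : aeval A c v ∈ cyc A v :=
  mem_cyc.2 ⟨c, rfl⟩

theorem self_mem_cyc (A : Module.End K V) (v : V) : v ∈ cyc A v :=
  mem_cyc.2 ⟨1, by simp⟩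

theorem aeval_mul_apply (A : Module.End K V) (f g : K[X]) (v : V) :
    aeval A (f * g) v = aeval A f (aeval A g v) := by
  rw [map_mul]; rfl

theorem aeval_comm_apply (A : Module.End K V) (f g : K[X]) (v : V) :
    aeval A f (aeval A g v) = aeval A g (aeval A f v) := by
  rw [← aeval_mul_apply, mul_comm, aeval_mul_apply]

theorem aeval_mem {A : Module.End K V} {U : Submodule K V} (hU : ∀ x ∈ U, A x ∈ U) (c : K[X]) :
    ∀ x ∈ U, aeval A c x ∈ U := by
  induction c using Polynomial.induction_on with
  | C a => intro x hx; simpa [Module.algebraMap_end_apply] using U.smul_mem a hx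
  | add f g hf hg => intro x hx; simpa using U.add_mem (hf x hx) (hg x hx)
  | monomial n a h =>
    intro x hx
    have := hU _ (h x hx)
    rw [pow_succ, ← mul_assoc, mul_comm, aeval_mul_apply]
    simpa using this

theorem cyc_invariant (A : Module.End K V) (v : V) : ∀ x ∈ cyc A v, A x ∈ cyc A v := by
  intro x hx
  obtain ⟨c, rfl⟩ := mem_cyc.1 hx
  exact mem_cyc.2 ⟨X * c, by rw [aeval_mul_apply, aeval_X]⟩

theorem cyc_le {A : Module.End K V} {U : Submodule K V} (hU : ∀ x ∈ U, A x ∈ U) {v : V}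
    (hv : v ∈ U) : cyc A v ≤ U := by
  intro x hx
  obtain ⟨c, rfl⟩ := mem_cyc.1 hx
  exact aeval_mem hU c v hv

theorem map_cyc (A : Module.End K V) (v : V) (g : K[X]) :
    (cyc A v).map (aeval A g) = cyc A (aeval A g v) := by
  ext x
  simp only [Submodule.mem_map, mem_cyc]
  constructor
  · rintro ⟨_, ⟨c, rfl⟩, rfl⟩
    exact ⟨c, aeval_comm_apply ..⟩
  · rintro ⟨c, rfl⟩
    exact ⟨_, ⟨c, rfl⟩, aeval_comm_apply ..⟩

theorem aeval_of_dvd {A : Module.End K V} {v : V} {q h : K[X]} (hq : aeval A q v = 0)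
    (hd : q ∣ h) : aeval A h v = 0 := by
  obtain ⟨c, rfl⟩ := hd
  rw [mul_comm, aeval_mul_apply, hq, map_zero]

theorem eq_zero_of_coprime {A : Module.End K V} {v : V} {q r : K[X]} (hq : aeval A q v = 0)
    (hr : aeval A r v = 0) (h : IsCoprime q r) : v = 0 := by
  obtain ⟨a, b, hab⟩ := h
  have : aeval A (a * q + b * r) v = 0 := by
    rw [map_add, LinearMap.add_apply, aeval_mul_apply, aeval_mul_apply, hq, hr]
    simp
  simpa [hab] using this

theorem aeval_eq_zero_of_mem_cyc {A : Module.End K V} {v x : V} {q : K[X]}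
    (hq : aeval A q v = 0) (hx : x ∈ cyc A v) : aeval A q x = 0 := by
  obtain ⟨c, rfl⟩ := mem_cyc.1 hx
  rw [aeval_comm_apply, hq, map_zero]

/-- The annihilator of the vector `v` is generated by `q`. -/
def HasAnn (A : Module.End K V) (v : V) (q : K[X]) : Prop := ∀ h : K[X], aeval A h v = 0 ↔ q ∣ h

/-- K[A]v is isomorphic to K[x]/(q), and the latter has a power basis of deg q elements. -/
theorem HasAnn.finrank_cyc {A : Module.End K V} {v : V} {q : K[X]} (h : HasAnn A v q)
    (hq : q ≠ 0) : Module.finrank K (cyc A v) = q.natDegree := by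
  have hker : LinearMap.ker ((LinearMap.applyₗ v) ∘ₗ (aeval A).toLinearMap : K[X] →ₗ[K] V) =
      (Ideal.span {q}).restrictScalars K := by
    ext x
    simp only [LinearMap.mem_ker, Submodule.restrictScalars_mem, Ideal.mem_span_singleton]
    exact h x
  have e := LinearMap.quotKerEquivRange
    ((LinearMap.applyₗ v) ∘ₗ (aeval A).toLinearMap : K[X] →ₗ[K] V)
  rw [hker] at e
  have e2 : (K[X] ⧸ (Ideal.span {q}).restrictScalars K) ≃ₗ[K] (K[X] ⧸ Ideal.span {q}) :=
    Submodule.Quotient.restrictScalarsEquiv K _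
  rw [cyc, ← (e2.symm.trans e).finrank_eq]
  exact (AdjoinRoot.powerBasis hq).finrank.trans (AdjoinRoot.powerBasis_dim hq)

theorem HasAnn.pow_mul {A : Module.End K V} {v : V} {p : K[X]} (hp : p ≠ 0) {j : ℕ}
    (h : HasAnn A v (p ^ j)) (k : ℕ) : HasAnn A (aeval A (p ^ k) v) (p ^ (j - k)) := by
  intro g
  rw [← aeval_mul_apply, h]
  rcases le_total k j with hkj | hkj
  · obtain ⟨i, rfl⟩ := Nat.exists_eq_add_of_le hkj
    rw [Nat.add_sub_cancel_left, pow_add, mul_comm g, mul_dvd_mul_iff_left (pow_ne_zero _ hp)]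
  · simp only [Nat.sub_eq_zero_of_le hkj, pow_zero, one_dvd, iff_true]
    exact (pow_dvd_pow p hkj).mul_left g

theorem HasAnn.coprime_mul {A : Module.End K V} {v : V} {p q : K[X]}
    (h : HasAnn A v p) (hc : IsCoprime p q) : HasAnn A (aeval A q v) p := by
  intro g
  rw [← aeval_mul_apply, h]
  exact ⟨fun hd => hc.dvd_of_dvd_mul_right hd, fun hd => hd.mul_right q⟩

end Cyclic

/-! ### The involution on polynomials -/

section Conj

variable [StarRing K]

/-- The polynomial `f̄`. -/
abbrev conj (f : K[X]) : K[X] := f.map (starRingEnd K)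

@[simp]
theorem conj_conj (f : K[X]) : conj (conj f) = f := by
  ext; simp [conj]

theorem conj_dvd {f g : K[X]} (h : f ∣ g) : conj f ∣ conj g :=
  Polynomial.map_dvd _ h

theorem conj_dvd_of {f g : K[X]} (hf : conj f = f) (h : f ∣ g) : f ∣ conj g := by
  simpa [hf] using conj_dvd h

theorem irreducible_conj {f : K[X]} (h : Irreducible f) : Irreducible (conj f) := by
  have := (MulEquiv.irreducible_iff (Polynomial.mapEquiv (starRingAut (R := K)))).2 h
  exact this

end Conj

theorem isCoprime_of_ne {p q : K[X]} (hp : Irreducible p) (hq : Irreducible q) (hpm : p.Monic)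
    (hqm : q.Monic) (h : p ≠ q) : IsCoprime p q := by
  refine (hp.coprime_iff_not_dvd).2 fun hd => h ?_
  exact eq_of_monic_of_associated hpm hqm ((hp.dvd_irreducible_iff_associated hq).1 hd)

/-! ### The Frobenius block and its functional -/

namespace FrobeniusBlock

theorem size_eq (Φ : FrobeniusBlock K) : Φ.size = Φ.m * Φ.p.natDegree := natDegree_pow _ _

theorem size_pos (Φ : FrobeniusBlock K) : 0 < Φ.size := by
  rw [size_eq]
  exact Nat.mul_pos Φ.pos Φ.irreducible.natDegree_pos

theorem aeval_chi (Φ : FrobeniusBlock K) : aeval Φ.matrix Φ.chi = 0 := by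
  rw [← Φ.charpoly_matrix]
  exact Matrix.aeval_self_charpoly _

theorem p_pow_mul_p (Φ : FrobeniusBlock K) : Φ.p ^ (Φ.m - 1) * Φ.p = Φ.chi := by
  rw [← pow_succ, Nat.sub_add_cancel Φ.pos, chi]

/-- The first basis vector, which is cyclic for the Frobenius block. -/
abbrev first (Φ : FrobeniusBlock K) : Fin Φ.size := ⟨0, Φ.size_pos⟩

theorem matrix_mulVec_single (Φ : FrobeniusBlock K) (j : Fin Φ.size) (h : (j : ℕ) + 1 < Φ.size) :
    Φ.matrix *ᵥ Pi.single j 1 = Pi.single ⟨j + 1, h⟩ 1 := by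
  ext i
  rw [Matrix.mulVec_single_one]
  simp only [Matrix.col_apply, matrix, Matrix.of_apply, Pi.single_apply, Fin.ext_iff]
  rw [if_neg h.ne]

theorem pow_mulVec_first (Φ : FrobeniusBlock K) (j : ℕ) (hj : j < Φ.size) :
    (Φ.matrix ^ j) *ᵥ Pi.single Φ.first 1 = Pi.single ⟨j, hj⟩ 1 := by
  induction j with
  | zero => rw [pow_zero, Matrix.one_mulVec]
  | succ j ih =>
    rw [pow_succ', ← Matrix.mulVec_mulVec, ih (by omega), matrix_mulVec_single _ _ hj]

/-- Since Φ^j e₀ = e_j, any matrix is recovered from first columns. This is what lets matrices be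
replaced by functionals on polynomials. -/
theorem mul_pow_apply_first (Φ : FrobeniusBlock K) (M : Matrix (Fin Φ.size) (Fin Φ.size) K)
    (j : Fin Φ.size) (i : Fin Φ.size) : (M * Φ.matrix ^ (j : ℕ)) i Φ.first = M i j := by
  have := congrFun (congrArg (M *ᵥ ·) (Φ.pow_mulVec_first j j.2)) i
  simp only [Matrix.mulVec_mulVec] at this
  rwa [Matrix.mulVec_single_one, Matrix.mulVec_single_one] at this

theorem aeval_apply_first (Φ : FrobeniusBlock K) {g : K[X]} (hg : g.natDegree < Φ.size)
    (j : Fin Φ.size) : aeval Φ.matrix g j Φ.first = g.coeff j := by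
  rw [aeval_eq_sum_range' hg, Matrix.sum_apply, Finset.sum_eq_single (j : ℕ)]
  · have := Φ.mul_pow_apply_first 1 j j
    rw [one_mul] at this
    rw [Matrix.smul_apply, this, Matrix.one_apply_eq, smul_eq_mul, mul_one]
  · intro i hi hij
    have := Φ.mul_pow_apply_first 1 ⟨i, Finset.mem_range.1 hi⟩ j
    rw [one_mul] at this
    rw [Matrix.smul_apply, this, Matrix.one_apply_ne fun h => hij (Fin.ext_iff.1 h).symm, smul_zero]
  · exact fun h => absurd (Finset.mem_range.2 j.2) h

/-- A polynomial annihilates the Frobenius block only if `χ` divides it. -/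
theorem chi_dvd_of_aeval_eq_zero (Φ : FrobeniusBlock K) {h : K[X]}
    (hh : aeval Φ.matrix h = 0) : Φ.chi ∣ h := by
  rw [← modByMonic_eq_zero_iff_dvd Φ.chi_monic]
  have h1 : aeval Φ.matrix (h %ₘ Φ.chi) = 0 := by
    have h2 := modByMonic_add_div h Φ.chi
    have h3 := congrArg (aeval Φ.matrix) h2
    rwa [map_add, map_mul, aeval_chi, zero_mul, add_zero, hh] at h3
  have hdeg : (h %ₘ Φ.chi).natDegree < Φ.size :=
    natDegree_modByMonic_lt _ Φ.chi_monic (fun h1 => Φ.size_pos.ne' (by rw [size, h1]; simp))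
  ext j
  by_cases hj : j < Φ.size
  · have := Φ.aeval_apply_first hdeg ⟨j, hj⟩
    rw [h1] at this
    exact this.symm
  · simp only [coeff_zero]
    exact coeff_eq_zero_of_natDegree_lt (by omega)

/-- The functional `g ↦ (M g(Φ))₀₀` on polynomials. -/
def ell (Φ : FrobeniusBlock K) (M : Matrix (Fin Φ.size) (Fin Φ.size) K) : K[X] →ₗ[K] K where
  toFun g := (M * aeval Φ.matrix g) Φ.first Φ.first
  map_add' f g := by simp [mul_add]
  map_smul' a f := by simp

theorem ell_apply (Φ : FrobeniusBlock K) (M : Matrix (Fin Φ.size) (Fin Φ.size) K) (g : K[X]) :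
    Φ.ell M g = (M * aeval Φ.matrix g) Φ.first Φ.first := rfl

theorem ell_of_dvd (Φ : FrobeniusBlock K) (M : Matrix (Fin Φ.size) (Fin Φ.size) K) {g : K[X]}
    (h : Φ.chi ∣ g) : Φ.ell M g = 0 := by
  obtain ⟨c, rfl⟩ := h
  simp [ell_apply, aeval_chi]

variable [StarRing K]

/-- The conditions on Φ₁ say that Φ is selfadjoint for the Hermitian matrix M, that is, Φ* M = M Φ.
Passing to polynomials conjugates the coefficients. -/
theorem IsPhiOne.conjTranspose_aeval_mul {Φ : FrobeniusBlock K}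
    {M : Matrix (Fin Φ.size) (Fin Φ.size) K} (h : Φ.IsPhiOne M) (g : K[X]) :
    (aeval Φ.matrix g)ᴴ * M = M * aeval Φ.matrix (conj g) := by
  obtain ⟨-, hM, hMΦ⟩ := h
  have h1 : Φ.matrixᴴ * M = M * Φ.matrix := by
    rw [Matrix.conjTranspose_mul, ← hM] at hMΦ
    exact hMΦ.symm
  induction g using Polynomial.induction_on with
  | C a =>
    simp [Algebra.algebraMap_eq_smul_one, Matrix.conjTranspose_smul, starRingEnd_apply]
  | add f g hf hg => simp [add_mul, mul_add, Matrix.conjTranspose_add, hf, hg]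
  | monomial n a h =>
    have e1 : (C a * X ^ (n + 1) : K[X]) = (C a * X ^ n) * X := by ring
    rw [e1, map_mul, aeval_X, Matrix.conjTranspose_mul, mul_assoc, h, ← mul_assoc, h1, mul_assoc]
    congr 1
    rw [conj, conj, Polynomial.map_mul (p := C a * X ^ n) (q := X),
      mul_comm _ (map (starRingEnd K) X), map_mul, map_X,
      aeval_X]

theorem IsPhiOne.ell_conj {Φ : FrobeniusBlock K}
    {M : Matrix (Fin Φ.size) (Fin Φ.size) K} (h : Φ.IsPhiOne M) (g : K[X]) :
    Φ.ell M (conj g) = star (Φ.ell M g) := by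
  rw [ell_apply, ell_apply, ← h.conjTranspose_aeval_mul, ← Matrix.conjTranspose_apply,
    Matrix.conjTranspose_mul, ← h.2.1]

/-- Write e_i = Φ^i e₀ and move the left power Φ^i across M by selfadjointness. So M is the Hankel
Gram matrix of a, b ↦ ell(ab) in the basis 1, x, …, x^(n-1). -/
theorem IsPhiOne.mul_aeval_apply {Φ : FrobeniusBlock K}
    {M : Matrix (Fin Φ.size) (Fin Φ.size) K} (h : Φ.IsPhiOne M) (g : K[X]) (i j : Fin Φ.size) :
    (M * aeval Φ.matrix g) i j = Φ.ell M (X ^ ((i : ℕ) + (j : ℕ)) * g) := by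
  have h1 := h.conjTranspose_aeval_mul (X ^ (i : ℕ))
  rw [show conj (X ^ (i : ℕ) : K[X]) = X ^ (i : ℕ) by simp [conj]] at h1
  have h2 : M * aeval Φ.matrix (X ^ ((i : ℕ) + (j : ℕ)) * g) =
      (aeval Φ.matrix (X ^ (i : ℕ) : K[X]))ᴴ * (M * aeval Φ.matrix g * Φ.matrix ^ (j : ℕ)) := by
    rw [← mul_assoc, ← mul_assoc, h1, mul_assoc, mul_assoc, ← aeval_X_pow (R := K) Φ.matrix,
      ← map_mul, ← map_mul]
    congr 2
    ring
  rw [ell_apply, h2, ← Φ.mul_pow_apply_first (M * aeval Φ.matrix g) j i]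
  generalize M * aeval Φ.matrix g * Φ.matrix ^ (j : ℕ) = N
  have h3 : (aeval Φ.matrix (X ^ (i : ℕ) : K[X]))ᴴ * N = (Nᴴ * Φ.matrix ^ (i : ℕ))ᴴ := by
    rw [Matrix.conjTranspose_mul, Matrix.conjTranspose_conjTranspose, aeval_X_pow]
  rw [h3, Matrix.conjTranspose_apply, mul_pow_apply_first, Matrix.conjTranspose_apply, star_star]

/-- The functional of `Φ₁` is nondegenerate modulo `χ`. -/
theorem IsPhiOne.chi_dvd {Φ : FrobeniusBlock K}
    {M : Matrix (Fin Φ.size) (Fin Φ.size) K} (h : Φ.IsPhiOne M) {g : K[X]}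
    (hg : ∀ c, Φ.ell M (c * g) = 0) : Φ.chi ∣ g := by
  apply Φ.chi_dvd_of_aeval_eq_zero
  have h0 : M * aeval Φ.matrix g = 0 := by
    ext i j
    rw [h.mul_aeval_apply, hg]; rfl
  have := congrArg (M⁻¹ * ·) h0
  simpa [← mul_assoc, Matrix.nonsing_inv_mul _ h.1] using this

/-- Multiplication by p^(m-1) identifies K[x]/(p) with the socle of K[x]/(χ), so nondegeneracy
modulo χ descends to nondegeneracy modulo p. -/
theorem IsPhiOne.p_dvd {Φ : FrobeniusBlock K}
    {M : Matrix (Fin Φ.size) (Fin Φ.size) K} (h : Φ.IsPhiOne M) {g : K[X]}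
    (hg : ∀ c, Φ.ell M (Φ.p ^ (Φ.m - 1) * (c * g)) = 0) : Φ.p ∣ g := by
  have : Φ.chi ∣ Φ.p ^ (Φ.m - 1) * g := h.chi_dvd fun c => by rw [← hg c]; congr 1; ring
  rw [← p_pow_mul_p] at this
  exact (mul_dvd_mul_iff_left (pow_ne_zero _ Φ.irreducible.ne_zero)).1 this

end FrobeniusBlock

end Algebra

/-! ### Conjugate blocks, existence of Φ₁, and vectors generating the summands -/

section Vectors

variable {K : Type*} [Field K] [StarRing K]

/-- The Frobenius block with characteristic polynomial `χ̄`. -/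
def FrobeniusBlock.conj (Φ : FrobeniusBlock K) : FrobeniusBlock K where
  p := SelfadjointOperator.conj Φ.p
  m := Φ.m
  monic := Φ.monic.map _
  irreducible := irreducible_conj Φ.irreducible
  pos := Φ.pos

namespace FrobeniusBlock

theorem chi_conj (Φ : FrobeniusBlock K) : Φ.conj.chi = SelfadjointOperator.conj Φ.chi :=
  (Polynomial.map_pow ..).symm

theorem conj_involutive (Φ : FrobeniusBlock K) : Φ.conj.conj = Φ := by
  ext1
  · exact conj_conj _
  · rfl

theorem size_conj (Φ : FrobeniusBlock K) : Φ.conj.size = Φ.size := by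
  rw [size, chi_conj, natDegree_map]; rfl

omit [StarRing K] in
theorem ext_chi {Φ Ψ : FrobeniusBlock K} (h : Φ.chi = Ψ.chi) : Φ = Ψ := by
  have hp : Φ.p = Ψ.p := by
    have h1 : Φ.p ∣ Ψ.p := by
      refine Φ.irreducible.prime.dvd_of_dvd_pow (n := Ψ.m) ?_
      change _ ∣ Ψ.chi
      rw [← h]
      exact dvd_pow_self _ Φ.pos.ne'
    exact eq_of_monic_of_associated Φ.monic Ψ.monic
      ((Φ.irreducible.dvd_irreducible_iff_associated Ψ.irreducible).1 h1)
  ext1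
  · exact hp
  · have := congrArg natDegree h
    rw [chi, chi, natDegree_pow, natDegree_pow, hp] at this
    exact Nat.eq_of_mul_eq_mul_right Ψ.irreducible.natDegree_pos this

-- The columns of Φ express multiplication by x on 1, x, …, x^(n-1) modulo χ; a genuine reduction by
-- χ occurs only in the last column.
omit [StarRing K] in
theorem chi_dvd_sum_sub (Φ : FrobeniusBlock K) (j : Fin Φ.size) : Φ.chi ∣
    (∑ k : Fin Φ.size, C (Φ.matrix k j) * X ^ (k : ℕ)) - X ^ ((j : ℕ) + 1) := by
  by_cases hj : (j : ℕ) + 1 = Φ.size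
  · have h1 := Φ.chi_monic.as_sum
    rw [← Fin.sum_univ_eq_sum_range (fun i => C (Φ.chi.coeff i) * X ^ i)] at h1
    have h2 : (∑ k : Fin Φ.size, C (Φ.matrix k j) * X ^ (k : ℕ)) - X ^ ((j : ℕ) + 1) =
        Φ.chi * (-1) := by
      conv_rhs => rw [h1]
      rw [hj]
      simp only [matrix, Matrix.of_apply, hj, if_true, C_neg, neg_mul, Finset.sum_neg_distrib]
      change -_ - X ^ Φ.chi.natDegree = _
      rw [mul_neg, mul_one, neg_add, sub_eq_neg_add]
      rfl
    exact ⟨_, h2⟩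
  · have hlt : (j : ℕ) + 1 < Φ.size := by omega
    rw [Finset.sum_eq_single ⟨j + 1, hlt⟩]
    · simp [matrix, hj]
    · intro k _ hk
      have : (k : ℕ) ≠ j + 1 := fun h => hk (Fin.ext h)
      simp [matrix, hj, this]
    · simp

/-- If `p̄ = p`, then `Φ₁` exists. -/
theorem hasPhiOne_of_conj_p (Φ : FrobeniusBlock K) (h : SelfadjointOperator.conj Φ.p = Φ.p) :
    Φ.HasPhiOne := by
  have hχ : SelfadjointOperator.conj Φ.chi = Φ.chi := by
    rw [← chi_conj, chi, chi]; exact congrArg (· ^ Φ.m) h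
  -- The witness is the Hankel matrix of the functional "coefficient of x^(n-1) in the remainder
  -- modulo χ". Its values on powers of x are fixed by the involution because χ̄ = χ.
  let lam : K[X] →ₗ[K] K := (lcoeff K (Φ.size - 1)) ∘ₗ (modByMonicHom Φ.chi)
  have lam_apply : ∀ g, lam g = (g %ₘ Φ.chi).coeff (Φ.size - 1) := fun g => rfl
  have lam_star : ∀ i : ℕ, star (lam (X ^ i)) = lam (X ^ i) := by
    intro i
    have h1 : (X ^ i %ₘ Φ.chi).map (starRingEnd K) = X ^ i %ₘ Φ.chi := by
      rw [map_modByMonic _ Φ.chi_monic]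
      rw [show Φ.chi.map (starRingEnd K) = Φ.chi from hχ]
      simp
    rw [lam_apply]
    conv_rhs => rw [← h1]
    rw [coeff_map, starRingEnd_apply]
  have lam_mul_chi : ∀ g, lam (Φ.chi * g) = 0 := by
    intro g
    rw [lam_apply, (modByMonic_eq_zero_iff_dvd Φ.chi_monic).2 (dvd_mul_right _ _), coeff_zero]
  let M : Matrix (Fin Φ.size) (Fin Φ.size) K := Matrix.of fun i j => lam (X ^ ((i : ℕ) + (j : ℕ)))
  have hM : M = Mᴴ := by
    ext i j
    rw [Matrix.conjTranspose_apply]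
    change lam _ = star (lam _)
    rw [lam_star, add_comm]
  have hMΦ : M * Φ.matrix = Matrix.of fun i j : Fin Φ.size =>
      lam (X ^ ((i : ℕ) + ((j : ℕ) + 1))) := by
    ext i j
    obtain ⟨c, hc⟩ := Φ.chi_dvd_sum_sub j
    rw [Matrix.mul_apply, Matrix.of_apply]
    have h1 : lam (X ^ (i : ℕ) * (∑ k : Fin Φ.size, C (Φ.matrix k j) * X ^ (k : ℕ))) =
        lam (X ^ (i : ℕ) * X ^ ((j : ℕ) + 1)) := by
      rw [← sub_eq_zero, ← map_sub, ← mul_sub, hc, mul_left_comm, lam_mul_chi]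
    rw [pow_add, ← h1, Finset.mul_sum, map_sum]
    refine Finset.sum_congr rfl fun k _ => ?_
    change lam _ * _ = _
    rw [mul_left_comm, ← pow_add, ← smul_eq_C_mul, map_smul, smul_eq_mul, mul_comm]
  refine ⟨M, ?_, hM, ?_⟩
  · rw [← Matrix.isUnit_iff_isUnit_det, ← Matrix.mulVec_injective_iff_isUnit]
    rw [← Matrix.coe_mulVecLin, ← LinearMap.ker_eq_bot, LinearMap.ker_eq_bot']
    intro z hz
    have hcoeff : ∀ i : Fin Φ.size,
        (∑ k : Fin Φ.size, C (z k) * X ^ (k : ℕ) : K[X]).coeff i = z i := by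
      intro i
      rw [finsetSum_coeff, Finset.sum_eq_single i]
      · simp
      · intro k _ hk
        rw [coeff_C_mul_X_pow, if_neg fun h => hk (Fin.ext h.symm)]
      · simp
    have hlam : ∀ i < Φ.size, lam (X ^ i * ∑ k : Fin Φ.size, C (z k) * X ^ (k : ℕ)) = 0 := by
      intro i hi
      have h1 : (M *ᵥ z) ⟨i, hi⟩ = 0 := congrFun hz _
      rw [← h1, Finset.mul_sum, map_sum]
      refine Finset.sum_congr rfl fun k _ => ?_
      rw [mul_left_comm, ← pow_add, ← smul_eq_C_mul, map_smul, smul_eq_mul, mul_comm]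
      rfl
    have hdeg : (∑ k : Fin Φ.size, C (z k) * X ^ (k : ℕ) : K[X]).degree < Φ.size := by
      refine degree_sum_fin_lt z
    generalize hg : (∑ k : Fin Φ.size, C (z k) * X ^ (k : ℕ) : K[X]) = g at hcoeff hlam hdeg
    suffices g = 0 by ext i; rw [← hcoeff, this]; simp
    by_contra hg0
    have hd := (natDegree_lt_iff_degree_lt hg0).2 hdeg
    -- Shifted to degree exactly n - 1, the polynomial g is its own remainder, and `lam` returns its
    -- nonzero leading coefficient.
    have h2 := hlam (Φ.size - 1 - g.natDegree) (by omega)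
    have h3 : (X ^ (Φ.size - 1 - g.natDegree) * g).natDegree = Φ.size - 1 := by
      rw [natDegree_X_pow_mul _ hg0]
      omega
    rw [lam_apply, (modByMonic_eq_self_iff Φ.chi_monic).2] at h2
    · nth_rw 2 [← h3] at h2
      rw [coeff_natDegree] at h2
      simp [hg0] at h2
    · refine degree_lt_degree ?_
      rw [h3]
      exact Nat.sub_lt Φ.size_pos one_pos
  · rw [hMΦ]
    ext i j
    rw [Matrix.conjTranspose_apply, Matrix.of_apply, Matrix.of_apply, lam_star]
    congr 2
    ring

end FrobeniusBlock

variable {V : Type*} [AddCommGroup V] [Module K V]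

/-- A selfadjoint operator with respect to an `ε`-Hermitian form. -/
structure IsPair (ε : K) (A : Module.End K V) (F : V →ₗ⋆[K] V →ₗ[K] K) : Prop where
  two : (2 : K) ≠ 0
  eps : ε = 1 ∨ ε = -1
  inv : (∃ a : K, star a ≠ a) → ε = 1
  herm : ∀ x y, F x y = ε * star (F y x)
  sa : ∀ x y, F x (A y) = F (A x) y

namespace IsPair

variable {ε : K} {A : Module.End K V} {F : V →ₗ⋆[K] V →ₗ[K] K}

theorem star_eps (h : IsPair ε A F) : star ε = ε := by
  rcases h.eps with h | h <;> simp [h]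

theorem eps_sq (h : IsPair ε A F) : ε * ε = 1 := by
  rcases h.eps with h | h <;> simp [h]

theorem eps_ne (h : IsPair ε A F) (he : ε ≠ 1) : ε = -1 ∧ ∀ a : K, star a = a :=
  ⟨h.eps.resolve_left he, fun a => by_contra fun ha => he (h.inv ⟨a, ha⟩)⟩

theorem eq_zero_symm (h : IsPair ε A F) {x y : V} (h0 : F x y = 0) : F y x = 0 := by
  rw [h.herm, h0, star_zero, mul_zero]

theorem conj_eq (h : IsPair ε A F) (he : ε ≠ 1) (f : K[X]) : conj f = f := by
  ext i
  rw [conj, coeff_map, starRingEnd_apply, (h.eps_ne he).2]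

theorem adj (h : IsPair ε A F) (g : K[X]) : ∀ x y, F (aeval A (conj g) x) y = F x (aeval A g y) := by
  induction g using Polynomial.induction_on with
  | C a => intro x y; simp [conj, Module.algebraMap_end_apply]
  | add f g hf hg => intro x y; simp only [conj] at hf hg ⊢; simp [hf, hg]
  | monomial n a hn =>
    intro x y
    rw [show (C a * X ^ (n + 1) : K[X]) = (C a * X ^ n) * X by ring,
      show conj ((C a * X ^ n) * X : K[X]) = X * conj (C a * X ^ n) by
        rw [conj, conj, Polynomial.map_mul (p := C a * X ^ n), map_X, mul_comm],
      aeval_mul_apply, aeval_mul_apply, aeval_X, ← h.sa, hn]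

theorem adj' (h : IsPair ε A F) (g : K[X]) (x y : V) :
    F (aeval A g x) y = F x (aeval A (conj g) y) := by
  rw [← h.adj, conj_conj]

end IsPair

/-- Vectors `v` and `w` that generate a hyperbolic summand of type (i). -/
structure IsHyperbolicPair (A : Module.End K V) (F : V →ₗ⋆[K] V →ₗ[K] K) (Φ : FrobeniusBlock K)
    (v w : V) : Prop where
  ann_left : aeval A Φ.chi v = 0
  ann_right : aeval A Φ.conj.chi w = 0
  isotropic_left : ∀ c : K[X], F v (aeval A c v) = 0
  isotropic_right : ∀ c : K[X], F w (aeval A c w) = 0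
  pairing : ∃ c, F w (aeval A (Φ.p ^ (Φ.m - 1) * c) v) ≠ 0

/-- The vector `v` generates a cyclic summand on which the form is given by the functional `l`. -/
structure IsCyclicVector (A : Module.End K V) (F : V →ₗ⋆[K] V →ₗ[K] K) (Φ : FrobeniusBlock K)
    (l : K[X] → K) (v : V) : Prop where
  ann : aeval A Φ.chi v = 0
  form : ∀ c, F v (aeval A c v) = l c

-- The gcd of a and p^m is a power p^k with k ≤ m - 1, so Bézout applies: every nonzero ideal of
-- K[x]/(p^m) contains the socle.
omit [StarRing K] in
theorem exists_eq_of_not_dvd {p a : K[X]} (hp : Irreducible p) {m : ℕ} (h : ¬ p ^ m ∣ a) :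
    ∃ s t, p ^ (m - 1) = s * a + t * p ^ m := by
  classical
  obtain ⟨k, hk, hass⟩ := (dvd_prime_pow hp.prime m).1 (EuclideanDomain.gcd_dvd_right a (p ^ m))
  have hkm : k ≤ m - 1 := by
    by_contra hkm
    have : k = m := by omega
    subst this
    exact h (hass.symm.dvd.trans (EuclideanDomain.gcd_dvd_left _ _))
  obtain ⟨r, hr⟩ := hass.dvd.trans (pow_dvd_pow p hkm)
  refine ⟨r * EuclideanDomain.gcdA a (p ^ m), r * EuclideanDomain.gcdB a (p ^ m), ?_⟩
  rw [hr, EuclideanDomain.gcd_eq_gcd_ab]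
  ring

namespace IsHyperbolicPair

variable {ε : K} {A : Module.End K V} {F : V →ₗ⋆[K] V →ₗ[K] K} {Φ : FrobeniusBlock K} {v w : V}

/-- The two generators play symmetric roles up to conjugating Φ, so statements need proof only for
`v`. -/
theorem swap (H : IsPair ε A F) (h : IsHyperbolicPair A F Φ v w) :
    IsHyperbolicPair A F Φ.conj w v where
  ann_left := h.ann_right
  ann_right := by rw [Φ.conj_involutive]; exact h.ann_left
  isotropic_left := h.isotropic_right
  isotropic_right := h.isotropic_left
  pairing := by
    obtain ⟨c, hc⟩ := h.pairing
    refine ⟨conj c, fun h0 => hc ?_⟩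
    rw [← H.adj]
    apply H.eq_zero_symm
    rw [← h0]
    congr 2
    simp [conj, FrobeniusBlock.conj]

/-- If χ did not divide a, the ideal generated by a modulo χ would contain p^(m-1), contradicting
`pairing`. Thus nondegeneracy on the socle suffices. -/
theorem chi_dvd (h : IsHyperbolicPair A F Φ v w) {a : K[X]}
    (ha : ∀ c, F w (aeval A (c * a) v) = 0) : Φ.chi ∣ a := by
  by_contra hd
  obtain ⟨s, t, hst⟩ := exists_eq_of_not_dvd Φ.irreducible hd
  obtain ⟨c, hc⟩ := h.pairing
  apply hc
  have h1 := h.ann_left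
  rw [FrobeniusBlock.chi] at h1
  rw [hst, add_mul, map_add, LinearMap.add_apply, map_add, mul_right_comm t, mul_right_comm s, ha,
    aeval_mul_apply _ _ (Φ.p ^ Φ.m), h1]
  simp

theorem hasAnn (h : IsHyperbolicPair A F Φ v w) : HasAnn A v Φ.chi := by
  refine fun a => ⟨fun ha => h.chi_dvd fun c => ?_, aeval_of_dvd h.ann_left⟩
  rw [aeval_mul_apply, ha]
  simp

theorem eq_zero_left (h : IsHyperbolicPair A F Φ v w) {x : V} (hx : x ∈ cyc A v)
    (h0 : ∀ c : K[X], F w (aeval A c x) = 0) : x = 0 := by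
  obtain ⟨a, rfl⟩ := mem_cyc.1 hx
  exact (h.hasAnn a).2 (h.chi_dvd fun c => by rw [aeval_mul_apply, h0])

theorem orth_left (H : IsPair ε A F) (h : IsHyperbolicPair A F Φ v w) {x y : V} (hx : x ∈ cyc A v)
    (hy : y ∈ cyc A v) : F x y = 0 := by
  obtain ⟨a, rfl⟩ := mem_cyc.1 hx
  obtain ⟨b, rfl⟩ := mem_cyc.1 hy
  rw [H.adj', ← aeval_mul_apply, h.isotropic_left]

/-- Each half is totally isotropic, so pairing with one half sees only the component in the other.
-/
theorem nondeg (H : IsPair ε A F) (h : IsHyperbolicPair A F Φ v w) {x : V}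
    (hx : x ∈ cyc A v ⊔ cyc A w) (h0 : ∀ y ∈ cyc A v ⊔ cyc A w, F y x = 0) : x = 0 := by
  obtain ⟨x1, h1, x2, h2, rfl⟩ := Submodule.mem_sup.1 hx
  have hx1 : x1 = 0 := by
    refine h.eq_zero_left h1 fun c => ?_
    rw [← H.adj]
    have := h0 (aeval A (conj c) w) (Submodule.mem_sup_right (aeval_mem_cyc _ _ _))
    rwa [map_add, (h.swap H).orth_left H (aeval_mem_cyc _ _ _) h2, add_zero] at this
  have hx2 : x2 = 0 := by
    refine (h.swap H).eq_zero_left h2 fun c => ?_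
    rw [← H.adj]
    have := h0 (aeval A (conj c) v) (Submodule.mem_sup_left (aeval_mem_cyc _ _ _))
    rwa [map_add, h.orth_left H (aeval_mem_cyc _ _ _) h1, zero_add] at this
  rw [hx1, hx2, add_zero]

theorem disjoint (H : IsPair ε A F) (h : IsHyperbolicPair A F Φ v w) :
    Disjoint (cyc A v) (cyc A w) := by
  rw [Submodule.disjoint_def]
  intro x hx hx'
  refine h.eq_zero_left hx fun c => ?_
  exact (h.swap H).orth_left H (self_mem_cyc _ _) (aeval_mem (cyc_invariant A w) c x hx')

end IsHyperbolicPair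

namespace IsCyclicVector

variable {ε : K} {A : Module.End K V} {F : V →ₗ⋆[K] V →ₗ[K] K} {Φ : FrobeniusBlock K} {v : V}
  {l : K[X] → K}

theorem form_eq (H : IsPair ε A F) (h : IsCyclicVector A F Φ l v) (a b : K[X]) :
    F (aeval A a v) (aeval A b v) = l (conj a * b) := by
  rw [H.adj', ← aeval_mul_apply, h.form]

theorem hasAnn (h : IsCyclicVector A F Φ l v) (hl : ∀ a, (∀ c, l (c * a) = 0) → Φ.chi ∣ a) :
    HasAnn A v Φ.chi := by
  refine fun a => ⟨fun ha => hl _ fun c => ?_, aeval_of_dvd h.ann⟩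
  rw [← h.form, aeval_mul_apply, ha]
  simp

theorem nondeg (H : IsPair ε A F) (h : IsCyclicVector A F Φ l v)
    (hl : ∀ a, (∀ c, l (c * a) = 0) → Φ.chi ∣ a) {x : V}
    (hx : x ∈ cyc A v) (h0 : ∀ y ∈ cyc A v, F y x = 0) : x = 0 := by
  obtain ⟨a, rfl⟩ := mem_cyc.1 hx
  refine (h.hasAnn hl a).2 (hl _ fun c => ?_)
  rw [← h.form, aeval_mul_apply, ← H.adj]
  exact h0 _ (aeval_mem_cyc _ _ _)

end IsCyclicVector

end Vectors

/-! ### From generating vectors to the matrices of the summands and back -/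

section Frames

variable {K : Type*} [Field K] [StarRing K] {V : Type*} [AddCommGroup V] [Module K V]

theorem conjTranspose_aeval {ι : Type*} [Fintype ι] [DecidableEq ι] (M : Matrix ι ι K) (g : K[X]) :
    (aeval M g)ᴴ = aeval Mᴴ (conj g) := by
  induction g using Polynomial.induction_on with
  | C a => simp [Algebra.algebraMap_eq_smul_one, Matrix.conjTranspose_smul, starRingEnd_apply]
  | add f g hf hg => simp only [conj] at *; simp [Matrix.conjTranspose_add, hf, hg]
  | monomial n a _ =>
    simp [Algebra.algebraMap_eq_smul_one, Matrix.conjTranspose_pow,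
      starRingEnd_apply]

/-- On the vectors `y`, the operator and the form are given by the matrices `M` and `G`. -/
structure IsFrame (A : Module.End K V) (F : V →ₗ⋆[K] V →ₗ[K] K) {ι : Type*} [Fintype ι]
    (M G : Matrix ι ι K) (y : ι → V) : Prop where
  op : ∀ j, A (y j) = ∑ i, M i j • y i
  form : ∀ i j, F (y i) (y j) = G i j

namespace IsFrame

variable {A : Module.End K V} {F : V →ₗ⋆[K] V →ₗ[K] K} {ι : Type*} [Fintype ι] [DecidableEq ι]
  {M G : Matrix ι ι K} {y : ι → V}

theorem aeval_apply (h : IsFrame A F M G y) (g : K[X]) (j : ι) :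
    aeval A g (y j) = ∑ i, aeval M g i j • y i := by
  induction g using Polynomial.induction_on generalizing j with
  | C a =>
    simp [Algebra.algebraMap_eq_smul_one, Matrix.one_apply]
  | add f g hf hg => simp [hf, hg, add_smul, Finset.sum_add_distrib]
  | monomial n a hn =>
    rw [show (C a * X ^ (n + 1) : K[X]) = (C a * X ^ n) * X by ring, aeval_mul_apply, aeval_X,
      h.op, map_sum, map_mul (aeval M), aeval_X]
    simp_rw [map_smul, hn, Finset.smul_sum, smul_smul, Matrix.mul_apply, Finset.sum_smul]
    rw [Finset.sum_comm]
    simp_rw [mul_comm]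

theorem form_aeval (h : IsFrame A F M G y) (g : K[X]) (i j : ι) :
    F (y i) (aeval A g (y j)) = (G * aeval M g) i j := by
  rw [h.aeval_apply, map_sum, Matrix.mul_apply]
  refine Finset.sum_congr rfl fun k _ => ?_
  rw [map_smul, h.form, smul_eq_mul, mul_comm]

omit [DecidableEq ι] in
theorem span_invariant (h : IsFrame A F M G y) :
    ∀ x ∈ Submodule.span K (Set.range y), A x ∈ Submodule.span K (Set.range y) := by
  intro x hx
  induction hx using Submodule.span_induction with
  | mem x hx =>
    obtain ⟨j, rfl⟩ := hx
    rw [h.op]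
    exact Submodule.sum_mem _ fun i _ => Submodule.smul_mem _ _ (Submodule.subset_span ⟨i, rfl⟩)
  | zero => simp
  | add x y _ _ hx hy => rw [map_add]; exact Submodule.add_mem _ hx hy
  | smul a x _ hx => rw [map_smul]; exact Submodule.smul_mem _ _ hx

omit [DecidableEq ι] in
theorem cyc_le_span (h : IsFrame A F M G y) (j : ι) :
    cyc A (y j) ≤ Submodule.span K (Set.range y) :=
  cyc_le h.span_invariant (Submodule.subset_span ⟨j, rfl⟩)

theorem aeval_first {Φ : FrobeniusBlock K} {G : Matrix (Fin Φ.size) (Fin Φ.size) K}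
    {y : Fin Φ.size → V} (h : IsFrame A F Φ.matrix G y) (j : Fin Φ.size) :
    aeval A (X ^ (j : ℕ) : K[X]) (y Φ.first) = y j := by
  rw [h.aeval_apply, aeval_X_pow, Finset.sum_eq_single j]
  · rw [← one_mul (Φ.matrix ^ (j : ℕ)), Φ.mul_pow_apply_first]
    simp
  · intro k _ hk
    rw [← one_mul (Φ.matrix ^ (j : ℕ)), Φ.mul_pow_apply_first, Matrix.one_apply_ne hk, zero_smul]
  · simp

theorem span_eq_cyc {Φ : FrobeniusBlock K} {G : Matrix (Fin Φ.size) (Fin Φ.size) K}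
    {y : Fin Φ.size → V} (h : IsFrame A F Φ.matrix G y) :
    Submodule.span K (Set.range y) = cyc A (y Φ.first) := by
  refine le_antisymm (Submodule.span_le.2 ?_) (h.cyc_le_span _)
  rintro _ ⟨j, rfl⟩
  rw [← h.aeval_first j]
  exact aeval_mem_cyc _ _ _

theorem aeval_chi_first {Φ : FrobeniusBlock K} {G : Matrix (Fin Φ.size) (Fin Φ.size) K}
    {y : Fin Φ.size → V} (h : IsFrame A F Φ.matrix G y) :
    aeval A Φ.chi (y Φ.first) = 0 := by
  rw [h.aeval_apply, Φ.aeval_chi]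
  simp

end IsFrame

/-- The powers of `A` applied to a vector annihilated by `χ` form a frame. -/
theorem isFrame_pow {A : Module.End K V} {F : V →ₗ⋆[K] V →ₗ[K] K} {Φ : FrobeniusBlock K} {v : V}
    (hv : aeval A Φ.chi v = 0) (G : Matrix (Fin Φ.size) (Fin Φ.size) K)
    (hG : ∀ i j : Fin Φ.size, F (aeval A (X ^ (i : ℕ) : K[X]) v)
      (aeval A (X ^ (j : ℕ) : K[X]) v) = G i j) :
    IsFrame A F Φ.matrix G (fun j : Fin Φ.size => aeval A (X ^ (j : ℕ) : K[X]) v) where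
  op j := by
    have h1 := aeval_of_dvd hv (Φ.chi_dvd_sum_sub j)
    rw [map_sub, LinearMap.sub_apply, sub_eq_zero, map_sum, LinearMap.sum_apply] at h1
    have h2 : A (aeval A (X ^ (j : ℕ) : K[X]) v) = aeval A (X ^ ((j : ℕ) + 1) : K[X]) v := by
      rw [pow_succ', aeval_mul_apply, aeval_X]
    rw [h2, ← h1]
    refine Finset.sum_congr rfl fun k _ => ?_
    rw [← smul_eq_C_mul, map_smul, LinearMap.smul_apply]
  form := hG

/-- The subspace `U` is generated by vectors which give a summand. -/
def Generates (P : (Φ : FrobeniusBlock K) → Matrix (Fin Φ.size) (Fin Φ.size) K)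
    (A : Module.End K V) (F : V →ₗ⋆[K] V →ₗ[K] K) : Summand K → Submodule K V → Prop
  | .typeI Φ, U => ∃ v w, IsHyperbolicPair A F Φ v w ∧ U = cyc A v ⊔ cyc A w
  | .typeII Φ f, U =>
    ∃ v, IsCyclicVector A F Φ (fun c => Φ.ell (P Φ) (f * c)) v ∧ U = cyc A v

omit [StarRing K] in
theorem isCoprime_chi {Φ : FrobeniusBlock K} {f : K[X]} (hf : f ≠ 0) (hd : f.degree < Φ.p.degree) :
    IsCoprime Φ.chi f :=
  ((Φ.irreducible.coprime_iff_not_dvd).2 fun h =>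
    hf (eq_zero_of_dvd_of_degree_lt h hd)).pow_left

/-- As f is nonzero of degree less than deg p, it is a unit modulo χ; hence g ↦ ell(fg) is as
nondegenerate as `ell`. -/
theorem FrobeniusBlock.IsPhiOne.chi_dvd_of_mul {Φ : FrobeniusBlock K}
    {M : Matrix (Fin Φ.size) (Fin Φ.size) K} (h : Φ.IsPhiOne M) {f : K[X]} (hf : f ≠ 0)
    (hd : f.degree < Φ.p.degree) (a : K[X]) (ha : ∀ c, Φ.ell M (f * (c * a)) = 0) :
    Φ.chi ∣ a :=
  (isCoprime_chi hf hd).dvd_of_dvd_mul_left (h.chi_dvd fun c => by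
    rw [← ha c]; congr 1; ring)

section

variable {ε : K} {A : Module.End K V} {F : V →ₗ⋆[K] V →ₗ[K] K}
  {P : (Φ : FrobeniusBlock K) → Matrix (Fin Φ.size) (Fin Φ.size) K}

omit [StarRing K] in
theorem HasAnn.finrank_cyc_chi {Φ : FrobeniusBlock K} {v : V} (h : HasAnn A v Φ.chi) :
    Module.finrank K (cyc A v) = Φ.size :=
  h.finrank_cyc Φ.chi_monic.ne_zero

variable [FiniteDimensional K V]

theorem IsHyperbolicPair.finrank (H : IsPair ε A F) {Φ : FrobeniusBlock K} {v w : V}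
    (h : IsHyperbolicPair A F Φ v w) :
    Module.finrank K ↥(cyc A v ⊔ cyc A w) = Φ.size + Φ.size := by
  have h1 := Submodule.finrank_sup_add_finrank_inf_eq (cyc A v) (cyc A w)
  rw [(h.disjoint H).eq_bot, finrank_bot, add_zero] at h1
  rw [h1, h.hasAnn.finrank_cyc_chi, (h.swap H).hasAnn.finrank_cyc_chi, Φ.size_conj]

/-- The basis of `cyc A w` dual to a basis of `cyc A v`. -/
theorem IsHyperbolicPair.exists_frame (H : IsPair ε A F) {Φ : FrobeniusBlock K} {v w : V}
    (h : IsHyperbolicPair A F Φ v w) :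
    ∃ y : Fin Φ.size ⊕ Fin Φ.size → V,
      IsFrame A F (Matrix.fromBlocks Φ.matrix 0 0 Φ.matrixᴴ)
        (Matrix.fromBlocks 0 (ε • 1) 1 0) y ∧
      Submodule.span K (Set.range y) = cyc A v ⊔ cyc A w := by
  let u : Fin Φ.size → V := fun j => aeval A (X ^ (j : ℕ) : K[X]) v
  have hu : IsFrame A F Φ.matrix 0 u := isFrame_pow h.ann_left 0 fun i j =>
    h.orth_left H (aeval_mem_cyc _ _ _) (aeval_mem_cyc _ _ _)
  have hu0 : u Φ.first = v := by simp [u]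
  have huspan : Submodule.span K (Set.range u) = cyc A v := by rw [hu.span_eq_cyc, hu0]
  -- `T` records the pairings with the basis `u`. It is injective by nondegeneracy and surjective by
  -- dimension, which provides the dual basis `z`.
  let T : cyc A w →ₗ[K] (Fin Φ.size → K) := LinearMap.pi fun j => (F (u j)) ∘ₗ (cyc A w).subtype
  have hTinj : Function.Injective T := by
    rw [← LinearMap.ker_eq_bot, LinearMap.ker_eq_bot']
    rintro ⟨z, hz⟩ h0
    ext
    refine (h.swap H).eq_zero_left hz fun c => ?_
    rw [← H.adj]
    have h1 : aeval A (conj c) v ∈ Submodule.span K (Set.range u) := by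
      rw [huspan]; exact aeval_mem_cyc _ _ _
    generalize aeval A (conj c) v = x at h1
    induction h1 using Submodule.span_induction with
    | mem x hx =>
      obtain ⟨j, rfl⟩ := hx
      exact congrFun h0 j
    | zero => simp
    | add x y _ _ hx hy => simp [hx, hy]
    | smul a x _ hx => simp [hx]
  have hTsurj : Function.Surjective T := by
    refine (LinearMap.injective_iff_surjective_of_finrank_eq_finrank ?_).1 hTinj
    rw [(h.swap H).hasAnn.finrank_cyc_chi, Φ.size_conj, Module.finrank_fin_fun]
  -- The upper right block of the form is εI, hence ε here; then F(z_i, u_i) = ε ε̄ = 1.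
  choose z hz using fun i : Fin Φ.size => hTsurj (Pi.single i ε)
  have hz1 : ∀ i j, F (u j) (z i) = if j = i then ε else 0 := by
    intro i j
    have := congrFun (hz i) j
    rwa [Pi.single_apply] at this
  have hext : ∀ x y : cyc A w, (∀ j, F (u j) x = F (u j) y) → x = y := fun x y hxy =>
    hTinj (funext hxy)
  have hzu : ∀ i j, F (z i) (u j) = if i = j then 1 else 0 := by
    intro i j
    rw [H.herm, hz1]
    by_cases hij : j = i
    · rw [if_pos hij, if_pos hij.symm, H.star_eps, H.eps_sq]
    · rw [if_neg hij, if_neg (Ne.symm hij), star_zero, mul_zero]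
  refine ⟨Sum.elim u fun i => z i, ⟨?_, ?_⟩, ?_⟩
  · rintro (j | j)
    · simpa using hu.op j
    -- On the dual basis a selfadjoint operator acts by the conjugate transpose; equality is tested
    -- by pairing with each `u k`.
    · have h1 : (⟨A (z j), cyc_invariant A w _ (z j).2⟩ : cyc A w) = ∑ i, Φ.matrixᴴ i j • z i := by
        apply hext
        intro k
        simp only [Submodule.coe_sum, Submodule.coe_smul, map_sum, map_smul, hz1]
        rw [H.sa, hu.op]
        simp [hz1, mul_comm, starRingEnd_apply]
      have h2 := congrArg Subtype.val h1
      simpa using h2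
  · rintro (i | i) (j | j)
    · simpa using hu.form i j
    · simp [hz1, Matrix.one_apply]
    · simp [hzu, Matrix.one_apply]
    · simpa using (h.swap H).orth_left H (z i).2 (z j).2
  · rw [Set.Sum.elim_range, Submodule.span_union, huspan]
    congr 1
    refine le_antisymm (Submodule.span_le.2 ?_) ?_
    · rintro _ ⟨i, rfl⟩
      exact (z i).2
    · intro x hx
      have h1 : (⟨x, hx⟩ : cyc A w) = ∑ i, (ε * F (u i) x) • z i := by
        apply hext
        intro k
        simp only [Submodule.coe_sum, Submodule.coe_smul, map_sum, map_smul, hz1]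
        simp [mul_right_comm, H.eps_sq]
      have h2 : x = ∑ i, (ε * F (u i) x) • (z i : V) := by simpa using congrArg Subtype.val h1
      rw [h2]
      exact Submodule.sum_mem _ fun i _ => Submodule.smul_mem _ _ (Submodule.subset_span ⟨i, rfl⟩)

theorem isHyperbolicPair_of_frame (H : IsPair ε A F) {Φ : FrobeniusBlock K}
    {y : Fin Φ.size ⊕ Fin Φ.size → V}
    (hy : IsFrame A F (Matrix.fromBlocks Φ.matrix 0 0 Φ.matrixᴴ)
        (Matrix.fromBlocks 0 (ε • 1) 1 0) y) :
    ∃ v w, IsHyperbolicPair A F Φ v w ∧ Submodule.span K (Set.range y) = cyc A v ⊔ cyc A w := by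
  have hu : IsFrame A F Φ.matrix 0 (y ∘ Sum.inl) :=
    ⟨fun j => by simpa using hy.op (Sum.inl j),
      fun i j => by simpa using hy.form (Sum.inl i) (Sum.inl j)⟩
  have hz : IsFrame A F Φ.matrixᴴ 0 (y ∘ Sum.inr) :=
    ⟨fun j => by simpa using hy.op (Sum.inr j),
      fun i j => by simpa using hy.form (Sum.inr i) (Sum.inr j)⟩
  -- The last dual vector reads off the coefficient of x^(n-1). It pairs to 1 with the monic
  -- polynomial p^(m-1) x^(deg p - 1) of degree n - 1, and it generates the second half.
  let l : Fin Φ.size := ⟨Φ.size - 1, Nat.sub_lt Φ.size_pos one_pos⟩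
  have hH : IsHyperbolicPair A F Φ (y (Sum.inl Φ.first)) (y (Sum.inr l)) := by
    constructor
    · exact hu.aeval_chi_first
    · have h1 := hz.aeval_apply Φ.conj.chi l
      rw [Φ.chi_conj, ← conjTranspose_aeval, Φ.aeval_chi] at h1
      rw [Φ.chi_conj]
      simpa using h1
    · intro c
      simpa using hu.form_aeval c Φ.first Φ.first
    · intro c
      simpa using hz.form_aeval c l l
    · have hd : (Φ.p ^ (Φ.m - 1) * X ^ (Φ.p.natDegree - 1)).natDegree = Φ.size - 1 := by
        rw [((Φ.monic.pow _).natDegree_mul (monic_X_pow _)), natDegree_X_pow,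
          Φ.monic.natDegree_pow, Φ.size_eq]
        obtain ⟨k, hk⟩ := Nat.exists_eq_add_of_lt Φ.pos
        rw [hk, zero_add, Nat.add_sub_cancel, add_mul, one_mul,
          Nat.add_sub_assoc Φ.irreducible.natDegree_pos]
      refine ⟨X ^ (Φ.p.natDegree - 1), ?_⟩
      have h1 := hu.aeval_apply (Φ.p ^ (Φ.m - 1) * X ^ (Φ.p.natDegree - 1)) Φ.first
      rw [Function.comp_apply] at h1
      rw [h1, map_sum, Finset.sum_eq_single l]
      · rw [map_smul, Function.comp_apply, hy.form, Φ.aeval_apply_first (by rw [hd]; exact l.2)]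
        change coeff _ (Φ.size - 1) • _ ≠ _
        rw [← hd, coeff_natDegree, ((Φ.monic.pow _).mul (monic_X_pow _)).leadingCoeff]
        simp
      · intro i _ hi
        rw [map_smul, Function.comp_apply, hy.form]
        simp [hi.symm]
      · simp
  refine ⟨_, _, hH, ?_⟩
  have h1 : y = Sum.elim (y ∘ Sum.inl) (y ∘ Sum.inr) := by simp
  rw [h1, Set.Sum.elim_range, Submodule.span_union, hu.span_eq_cyc]
  congr 1
  refine (Submodule.eq_of_le_of_finrank_le (hz.cyc_le_span l) ?_).symm
  rw [Function.comp_apply, (hH.swap H).hasAnn.finrank_cyc_chi, Φ.size_conj]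
  exact (finrank_range_le_card _).trans (by simp)

end

end Frames

/-! ### Orthogonal decompositions and their matrix form -/

section Decomposition

variable {K : Type*} [Field K] [StarRing K] {V : Type*} [AddCommGroup V] [Module K V]

/-- The subspace `U` is the orthogonal sum of subspaces generated by the summands in the list. -/
def Decomp (P : (Φ : FrobeniusBlock K) → Matrix (Fin Φ.size) (Fin Φ.size) K)
    (A : Module.End K V) (F : V →ₗ⋆[K] V →ₗ[K] K) : List (Summand K) → Submodule K V → Prop
  | [], U => U = ⊥
  | S :: L, U => ∃ U₁ U₂, Generates P A F S U₁ ∧ Decomp P A F L U₂ ∧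
      (∀ x ∈ U₁, ∀ y ∈ U₂, F x y = 0) ∧ U = U₁ ⊔ U₂

/-- The form is nondegenerate on the subspace `U`. -/
def NondegOn (F : V →ₗ⋆[K] V →ₗ[K] K) (U : Submodule K V) : Prop :=
  ∀ x ∈ U, (∀ y ∈ U, F y x = 0) → x = 0

theorem NondegOn.disjoint {F : V →ₗ⋆[K] V →ₗ[K] K} {U₁ U₂ : Submodule K V} (h : NondegOn F U₁)
    (ho : ∀ x ∈ U₁, ∀ y ∈ U₂, F x y = 0) : Disjoint U₁ U₂ :=
  Submodule.disjoint_def.2 fun x h1 h2 => h x h1 fun y hy => ho y hy x h2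

theorem iSup_fin_succ {α : Type*} [CompleteLattice α] {n : ℕ} (f : Fin (n + 1) → α) :
    ⨆ i, f i = f 0 ⊔ ⨆ i : Fin n, f i.succ :=
  le_antisymm (iSup_le fun i => Fin.cases le_sup_left
    (fun i => le_sup_of_le_right (le_iSup (fun i : Fin n => f i.succ) i)) i)
    (sup_le (le_iSup f 0) (iSup_le fun i => le_iSup f i.succ))

omit [StarRing K] in
theorem sup_invariant {A : Module.End K V} {U₁ U₂ : Submodule K V} (h1 : ∀ x ∈ U₁, A x ∈ U₁)
    (h2 : ∀ x ∈ U₂, A x ∈ U₂) : ∀ x ∈ U₁ ⊔ U₂, A x ∈ U₁ ⊔ U₂ := by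
  intro x hx
  obtain ⟨y, hy, z, hz, rfl⟩ := Submodule.mem_sup.1 hx
  rw [map_add]
  exact Submodule.add_mem_sup (h1 y hy) (h2 z hz)

section

variable {ε : K} {A : Module.End K V} {F : V →ₗ⋆[K] V →ₗ[K] K}
  {P : (Φ : FrobeniusBlock K) → Matrix (Fin Φ.size) (Fin Φ.size) K} {S : Summand K}
  {L L' : List (Summand K)} {U : Submodule K V}

theorem Generates.invariant (h : Generates P A F S U) : ∀ x ∈ U, A x ∈ U := by
  rcases S with Φ | ⟨Φ, f⟩
  · obtain ⟨v, w, -, rfl⟩ := h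
    exact sup_invariant (cyc_invariant A v) (cyc_invariant A w)
  · obtain ⟨v, -, rfl⟩ := h
    exact cyc_invariant A v

theorem Decomp.invariant (h : Decomp P A F L U) : ∀ x ∈ U, A x ∈ U := by
  induction L generalizing U with
  | nil =>
    intro x hx
    have h0 : U = ⊥ := h
    subst h0
    simp_all
  | cons S L ih =>
    obtain ⟨U₁, U₂, h1, h2, -, rfl⟩ := h
    exact sup_invariant h1.invariant (ih h2)

theorem Generates.nondegOn (H : IsPair ε A F) (hP : ∀ Φ : FrobeniusBlock K, Φ.HasPhiOne → Φ.IsPhiOne (P Φ))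
    (hS : S.Admissible ε) (h : Generates P A F S U) : NondegOn F U := by
  rcases S with Φ | ⟨Φ, f⟩
  · obtain ⟨v, w, h, rfl⟩ := h
    exact fun x hx h0 => h.nondeg H hx h0
  · obtain ⟨v, h, rfl⟩ := h
    obtain ⟨-, h1, hf, -, hd⟩ := hS
    exact fun x hx h0 => h.nondeg H ((hP Φ h1).chi_dvd_of_mul hf hd) hx h0

theorem generates_iff [FiniteDimensional K V] (H : IsPair ε A F)
    (hP : ∀ Φ : FrobeniusBlock K, Φ.HasPhiOne → Φ.IsPhiOne (P Φ))
    (hS : S.Admissible ε) : Generates P A F S U ↔ ∃ y : S.Index → V,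
      IsFrame A F S.opMatrix (S.formMatrix P ε) y ∧ Submodule.span K (Set.range y) = U := by
  rcases S with Φ | ⟨Φ, f⟩
  · constructor
    · rintro ⟨v, w, h, rfl⟩
      exact h.exists_frame H
    · rintro ⟨y, hy, rfl⟩
      exact isHyperbolicPair_of_frame H hy
  · have hΦ := hP Φ hS.2.1
    constructor
    · rintro ⟨v, h, rfl⟩
      have hy : IsFrame A F Φ.matrix (P Φ * aeval Φ.matrix f)
          (fun j : Fin Φ.size => aeval A (X ^ (j : ℕ) : K[X]) v) := by
        refine isFrame_pow h.ann _ fun i j => ?_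
        rw [h.form_eq H, hΦ.mul_aeval_apply]
        congr 1
        simp [conj]
        ring
      refine ⟨_, hy, hy.span_eq_cyc.trans ?_⟩
      simp
    · rintro ⟨y, hy, rfl⟩
      have hy : IsFrame A F Φ.matrix (P Φ * aeval Φ.matrix f) y := hy
      refine ⟨y Φ.first, ⟨hy.aeval_chi_first, fun c => ?_⟩, hy.span_eq_cyc⟩
      rw [hy.form_aeval, mul_assoc, ← map_mul]
      rfl

theorem Generates.finrank [FiniteDimensional K V] (H : IsPair ε A F)
    (hP : ∀ Φ : FrobeniusBlock K, Φ.HasPhiOne → Φ.IsPhiOne (P Φ)) (hS : S.Admissible ε) (h : Generates P A F S U) :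
    Module.finrank K U = Fintype.card S.Index := by
  rcases S with Φ | ⟨Φ, f⟩
  · obtain ⟨v, w, h, rfl⟩ := h
    rw [h.finrank H]
    exact ((Fintype.card_sum ..).trans (by rw [Fintype.card_fin])).symm
  · obtain ⟨v, h, rfl⟩ := h
    obtain ⟨-, h1, hf, -, hd⟩ := hS
    rw [(h.hasAnn ((hP Φ h1).chi_dvd_of_mul hf hd)).finrank_cyc_chi]
    exact (Fintype.card_fin _).symm

theorem Decomp.finrank [FiniteDimensional K V] (H : IsPair ε A F)
    (hP : ∀ Φ : FrobeniusBlock K, Φ.HasPhiOne → Φ.IsPhiOne (P Φ)) (hL : ∀ S ∈ L, S.Admissible ε)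
    (h : Decomp P A F L U) :
    Module.finrank K U = (L.map fun S => Fintype.card S.Index).sum := by
  induction L generalizing U with
  | nil =>
    have h0 : U = ⊥ := h
    subst h0
    simp
  | cons S L ih =>
    obtain ⟨U₁, U₂, h1, h2, ho, rfl⟩ := h
    have hS := hL S (by simp)
    have h3 := Submodule.finrank_sup_add_finrank_inf_eq U₁ U₂
    rw [((h1.nondegOn H hP hS).disjoint ho).eq_bot, finrank_bot, add_zero] at h3
    rw [h3, h1.finrank H hP hS, ih (fun S hS => hL S (by simp [hS])) h2]
    simp

theorem Decomp.exists_frames [FiniteDimensional K V] (H : IsPair ε A F)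
    (hP : ∀ Φ : FrobeniusBlock K, Φ.HasPhiOne → Φ.IsPhiOne (P Φ)) (hL : ∀ S ∈ L, S.Admissible ε)
    (h : Decomp P A F L U) : ∃ y : (i : Fin L.length) → (L.get i).Index → V,
      (∀ i, IsFrame A F (L.get i).opMatrix ((L.get i).formMatrix P ε) (y i)) ∧
      (∀ i j, i ≠ j → ∀ a b, F (y i a) (y j b) = 0) ∧
      ⨆ i, Submodule.span K (Set.range (y i)) = U := by
  induction L generalizing U with
  | nil =>
    have h0 : U = ⊥ := h
    subst h0
    exact ⟨fun i => i.elim0, fun i => i.elim0, fun i => i.elim0, by simp⟩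
  | cons S L ih =>
    obtain ⟨U₁, U₂, h1, h2, ho, rfl⟩ := h
    obtain ⟨y, hy, hyU⟩ := (generates_iff H hP (hL S (by simp))).1 h1
    obtain ⟨z, hz, hzo, hzU⟩ := ih (fun S hS => hL S (by simp [hS])) h2
    have hmy : ∀ a, y a ∈ U₁ := fun a => hyU ▸ Submodule.subset_span ⟨a, rfl⟩
    have hmz : ∀ i a, z i a ∈ U₂ := fun i a =>
      hzU ▸ Submodule.mem_iSup_of_mem i (Submodule.subset_span ⟨a, rfl⟩)
    refine ⟨Fin.cons (α := fun i => ((S :: L).get i).Index → V) y z, ?_, ?_, ?_⟩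
    · intro i
      refine Fin.cases ?_ (fun i => ?_) i
      · exact hy
      · exact hz i
    · intro i j
      refine Fin.cases ?_ (fun i => ?_) i <;> refine Fin.cases ?_ (fun j => ?_) j
      · exact fun h => absurd rfl h
      · exact fun _ a b => ho _ (hmy a) _ (hmz j b)
      · exact fun _ a b => H.eq_zero_symm (ho _ (hmy b) _ (hmz i a))
      · exact fun hij a b => hzo i j (fun h => hij (congrArg _ h)) a b
    · refine (iSup_fin_succ _).trans ?_
      rw [← hyU, ← hzU]
      rfl

theorem decomp_of_frames [FiniteDimensional K V] (H : IsPair ε A F)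
    (hP : ∀ Φ : FrobeniusBlock K, Φ.HasPhiOne → Φ.IsPhiOne (P Φ)) (hL : ∀ S ∈ L, S.Admissible ε)
    (y : (i : Fin L.length) → (L.get i).Index → V)
    (hy : ∀ i, IsFrame A F (L.get i).opMatrix ((L.get i).formMatrix P ε) (y i))
    (hyo : ∀ i j, i ≠ j → ∀ a b, F (y i a) (y j b) = 0) :
    Decomp P A F L (⨆ i, Submodule.span K (Set.range (y i))) := by
  induction L with
  | nil =>
    have : IsEmpty (Fin ([] : List (Summand K)).length) := Fin.isEmpty
    exact iSup_of_empty _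
  | cons S L ih =>
    have h1 := (generates_iff (P := P) (S := S) H hP (hL S (by simp))).2 ⟨y 0, hy 0, rfl⟩
    have h2 := ih (fun S hS => hL S (by simp [hS])) (fun i => y i.succ) (fun i => hy i.succ)
      fun i j hij => hyo i.succ j.succ fun h => hij (Fin.succ_injective _ h)
    refine ⟨_, _, h1, h2, ?_, iSup_fin_succ _⟩
    intro x hx z hz
    induction hx using Submodule.span_induction with
    | zero => simp
    | add x y _ _ hx hy => simp [hx, hy]
    | smul a x _ hx => simp [hx]
    | mem x hx =>
      obtain ⟨a, rfl⟩ := hx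
      induction hz using Submodule.iSup_induction' with
      | zero => simp
      | add x y _ _ hx hy => simp [hx, hy]
      | mem i z hz =>
        induction hz using Submodule.span_induction with
        | zero => simp
        | add x y _ _ hx hy => simp [hx, hy]
        | smul a x _ hx => simp [hx]
        | mem z hz =>
          obtain ⟨b, rfl⟩ := hz
          exact hyo 0 i.succ (Fin.succ_ne_zero i).symm a b

theorem isFrame_blockDiagonal' {o : Type*} [Fintype o] [DecidableEq o] {n : o → Type*}
    [∀ i, Fintype (n i)] {M G : (i : o) → Matrix (n i) (n i) K}
    {y : (Σ i, n i) → V} :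
    IsFrame A F (Matrix.blockDiagonal' M) (Matrix.blockDiagonal' G) y ↔
      (∀ i, IsFrame A F (M i) (G i) fun a => y ⟨i, a⟩) ∧
      ∀ i j, i ≠ j → ∀ a b, F (y ⟨i, a⟩) (y ⟨j, b⟩) = 0 := by
  have hsum : ∀ j b, ∑ i, Matrix.blockDiagonal' M i ⟨j, b⟩ • y i =
      ∑ a, M j a b • y ⟨j, a⟩ := by
    intro j b
    rw [Fintype.sum_sigma, Finset.sum_eq_single j]
    · simp_rw [Matrix.blockDiagonal'_apply_eq]
    · intro i _ hi
      exact Finset.sum_eq_zero fun a _ => by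
        rw [Matrix.blockDiagonal'_apply_ne _ _ _ hi, zero_smul]
    · simp
  constructor
  · rintro ⟨h1, h2⟩
    refine ⟨fun i => ⟨fun b => ?_, fun a b => ?_⟩, fun i j hij a b => ?_⟩
    · rw [h1, hsum]
    · rw [h2, Matrix.blockDiagonal'_apply_eq]
    · rw [h2, Matrix.blockDiagonal'_apply_ne _ _ _ hij]
  · rintro ⟨h1, h2⟩
    constructor
    · rintro ⟨j, b⟩
      rw [(h1 j).op, hsum]
    · rintro ⟨i, a⟩ ⟨j, b⟩
      by_cases hij : i = j
      · subst hij
        rw [(h1 i).form, Matrix.blockDiagonal'_apply_eq]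
      · rw [h2 i j hij, Matrix.blockDiagonal'_apply_ne _ _ _ hij]

theorem isGivenBy_iff_exists_frame : IsGivenBy P ε A F L ↔
    ∃ b : Module.Basis (SumIndex L) K V,
      IsFrame A F (Matrix.blockDiagonal' fun i => (L.get i).opMatrix)
        (Matrix.blockDiagonal' fun i => (L.get i).formMatrix P ε) b := by
  refine exists_congr fun b => ⟨fun ⟨h1, h2⟩ => ⟨fun j => ?_, fun i j => ?_⟩,
    fun ⟨h1, h2⟩ => ⟨?_, ?_⟩⟩
  · rw [← h1]
    simp_rw [LinearMap.toMatrix_apply]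
    exact (b.sum_repr _).symm
  · rw [← h2]; rfl
  · ext i j
    rw [LinearMap.toMatrix_apply, h1]
    simp [Finsupp.single_apply]
  · ext i j
    exact h2 i j

/-- Linear independence of the combined frames is never checked directly: they span V and, by
`Decomp.finrank`, have as many members as the dimension. -/
theorem isGivenBy_iff [FiniteDimensional K V] (H : IsPair ε A F)
    (hP : ∀ Φ : FrobeniusBlock K, Φ.HasPhiOne → Φ.IsPhiOne (P Φ)) (hL : ∀ S ∈ L, S.Admissible ε) :
    IsGivenBy P ε A F L ↔ Decomp P A F L ⊤ := by
  rw [isGivenBy_iff_exists_frame]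
  constructor
  · rintro ⟨b, hb⟩
    obtain ⟨h1, h2⟩ := isFrame_blockDiagonal'.1 hb
    have h3 := decomp_of_frames H hP hL (fun i a => b ⟨i, a⟩) h1 h2
    convert h3
    rw [eq_comm, eq_top_iff, ← b.span_eq, Submodule.span_le]
    rintro _ ⟨⟨i, a⟩, rfl⟩
    exact Submodule.mem_iSup_of_mem i (Submodule.subset_span ⟨a, rfl⟩)
  · intro h
    have hfin := h.finrank H hP hL
    obtain ⟨y, h1, h2, h3⟩ := h.exists_frames H hP hL
    let x : SumIndex L → V := fun i => y i.1 i.2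
    have hspan : ⊤ ≤ Submodule.span K (Set.range x) := by
      rw [← h3, iSup_le_iff]
      intro i
      refine Submodule.span_mono ?_
      rintro _ ⟨a, rfl⟩
      exact ⟨⟨i, a⟩, rfl⟩
    have hcard : Fintype.card (SumIndex L) = Module.finrank K V := by
      rw [← finrank_top K V, hfin, Fintype.card_sigma, ← List.sum_ofFn]
      congr 1
      conv_rhs => rw [← List.ofFn_get L, List.map_ofFn]
      rfl
    refine ⟨basisOfTopLeSpanOfCardEqFinrank x hspan hcard, ?_⟩
    rw [coe_basisOfTopLeSpanOfCardEqFinrank]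
    exact isFrame_blockDiagonal'.2 ⟨h1, h2⟩

end

end Decomposition

section Existence

variable {K : Type*} [Field K] [StarRing K] {V : Type*} [AddCommGroup V] [Module K V]

/-! ### Splitting off a nondegenerate subspace -/

/-- The orthogonal complement of a subspace. -/
def orth (F : V →ₗ⋆[K] V →ₗ[K] K) (U : Submodule K V) : Submodule K V where
  carrier := {y | ∀ x ∈ U, F x y = 0}
  add_mem' ha hb x hx := by rw [map_add, ha x hx, hb x hx, add_zero]
  zero_mem' x _ := by simp
  smul_mem' a y hy x hx := by rw [map_smul, hy x hx, smul_zero]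

/-- Pairing with a basis of U is an injective, hence bijective, map from U to K^d. So the pairings
of x with U are also those of some y in U, the orthogonal projection of x. -/
theorem exists_sub_mem_orth [FiniteDimensional K V] {F : V →ₗ⋆[K] V →ₗ[K] K} {U : Submodule K V}
    (h : NondegOn F U) (x : V) : ∃ y ∈ U, x - y ∈ orth F U := by
  let b := Module.finBasis K U
  let T : U →ₗ[K] (Fin (Module.finrank K U) → K) :=
    LinearMap.pi fun j => (F (b j)) ∘ₗ U.subtype
  have hext : ∀ z, (∀ j, F (b j) z = 0) → z ∈ orth F U := by
    intro z hz y hy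
    have h1 := b.sum_repr ⟨y, hy⟩
    have h2 : y = ∑ i, b.repr ⟨y, hy⟩ i • (b i : V) := by
      have h3 := congrArg Subtype.val h1
      rw [Submodule.coe_sum] at h3
      exact h3.symm
    rw [h2, map_sum, LinearMap.sum_apply]
    exact Finset.sum_eq_zero fun i _ => by simp [hz i]
  have hTinj : Function.Injective T := by
    rw [← LinearMap.ker_eq_bot, LinearMap.ker_eq_bot']
    rintro ⟨z, hz⟩ h0
    ext
    exact h z hz (hext z fun j => congrFun h0 j)
  have hTsurj : Function.Surjective T := by
    refine (LinearMap.injective_iff_surjective_of_finrank_eq_finrank ?_).1 hTinj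
    rw [Module.finrank_fin_fun]
  obtain ⟨y, hy⟩ := hTsurj fun j => F (b j) x
  refine ⟨y, y.2, hext _ fun j => ?_⟩
  rw [map_sub, sub_eq_zero]
  exact (congrFun hy j).symm

variable {ε : K} {A : Module.End K V} {F : V →ₗ⋆[K] V →ₗ[K] K}
  {P : (Φ : FrobeniusBlock K) → Matrix (Fin Φ.size) (Fin Φ.size) K}

theorem orth_invariant (H : IsPair ε A F) {U : Submodule K V} (hU : ∀ x ∈ U, A x ∈ U) :
    ∀ x ∈ orth F U, A x ∈ orth F U := by
  intro x hx y hy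
  rw [H.sa]
  exact hx _ (hU y hy)

theorem sup_orth_eq [FiniteDimensional K V] {U₁ U : Submodule K V}
    (h1 : NondegOn F U₁) (hle : U₁ ≤ U) : U₁ ⊔ (U ⊓ orth F U₁) = U := by
  refine le_antisymm (sup_le hle inf_le_left) fun x hx => ?_
  obtain ⟨y, hy, hxy⟩ := exists_sub_mem_orth h1 x
  rw [← add_sub_cancel y x]
  exact Submodule.add_mem_sup hy ⟨U.sub_mem hx (hle hy), hxy⟩

theorem nondegOn_inf_orth [FiniteDimensional K V] {U₁ U : Submodule K V}
    (h : NondegOn F U) (h1 : NondegOn F U₁) (hle : U₁ ≤ U) : NondegOn F (U ⊓ orth F U₁) := by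
  intro x hx h0
  refine h x hx.1 fun y hy => ?_
  rw [← sup_orth_eq h1 hle] at hy
  obtain ⟨z, hz, w, hw, rfl⟩ := Submodule.mem_sup.1 hy
  rw [map_add, LinearMap.add_apply, hx.2 z hz, h0 w hw, add_zero]

theorem finrank_inf_orth [FiniteDimensional K V] {U₁ U : Submodule K V}
    (h1 : NondegOn F U₁) (hle : U₁ ≤ U) :
    Module.finrank K U = Module.finrank K U₁ + Module.finrank K ↥(U ⊓ orth F U₁) := by
  have h3 := Submodule.finrank_sup_add_finrank_inf_eq U₁ (U ⊓ orth F U₁)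
  rw [(h1.disjoint fun x hx y (hy : y ∈ U ⊓ orth F U₁) => hy.2 x hx).eq_bot, finrank_bot, add_zero,
    sup_orth_eq h1 hle] at h3
  exact h3

/-! ### Normalization of cyclic vectors -/

theorem conj_C_half : conj (C (2⁻¹ : K)) = C 2⁻¹ := by
  rw [conj, map_C, map_inv₀, map_ofNat]

omit [StarRing K] in
theorem C_half_mul_two (two : (2 : K) ≠ 0) : (C (2⁻¹ : K)) * 2 = 1 := by
  rw [show (2 : K[X]) = C 2 from (C_ofNat 2).symm, ← C_mul, inv_mul_cancel₀ two, C_1]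

/-- A Bézout inverse of f modulo p and its conjugate are both inverses, since p and f are
self-conjugate. Their average is a self-conjugate inverse. -/
theorem exists_conj_inverse (two : (2 : K) ≠ 0) {p f : K[X]} (hp : Irreducible p)
    (hpc : conj p = p) (hf : conj f = f) (hpf : ¬ p ∣ f) : ∃ g, conj g = g ∧ p ∣ 1 - g * f := by
  obtain ⟨s, t, hst⟩ := (hp.coprime_iff_not_dvd).2 hpf
  have hc := conj_C_half (K := K)
  refine ⟨C 2⁻¹ * (t + conj t), ?_, C 2⁻¹ * (s + conj s), ?_⟩
  · have h1 : conj (C 2⁻¹ * (t + conj t)) = conj (C 2⁻¹) * (conj t + conj (conj t)) := by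
      simp only [conj, Polynomial.map_mul, Polynomial.map_add]
    rw [h1, conj_conj, hc, add_comm]
  · have h2 : conj s * p + conj t * f = 1 := by
      have := congrArg conj hst
      rw [conj, conj, Polynomial.map_add, Polynomial.map_mul, Polynomial.map_mul,
        Polynomial.map_one] at this
      rwa [show p.map (starRingEnd K) = p from hpc, show f.map (starRingEnd K) = f from hf] at this
    have h3 := C_half_mul_two two
    linear_combination (-1 : K[X]) * h3 - C 2⁻¹ * hst - C 2⁻¹ * h2

/-- Newton iteration: if `h ≡ f` modulo `p`, then `a² h ≡ f` modulo `p ^ k` for some `a ≡ 1`. -/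
theorem exists_sq_mul_sub_dvd (two : (2 : K) ≠ 0) {p f h : K[X]} (hp : Irreducible p)
    (hpc : conj p = p) (hf : conj f = f) (hh : conj h = h) (hpf : ¬ p ∣ f) (hd : p ∣ h - f)
    (k : ℕ) : ∃ a, conj a = a ∧ p ∣ a - 1 ∧ p ^ (k + 1) ∣ a ^ 2 * h - f := by
  obtain ⟨g, hg, q, hq⟩ := exists_conj_inverse two hp hpc hf hpf
  induction k with
  | zero => exact ⟨1, by simp [conj], by simp, by simpa using hd⟩
  | succ k ih =>
    obtain ⟨a, ha, hpa, e, he⟩ := ih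
    have h3 := C_half_mul_two two
    have hc := conj_C_half (K := K)
    have hE : conj (a ^ 2 * h - f) = a ^ 2 * h - f := by
      simp only [conj] at *
      rw [Polynomial.map_sub, Polynomial.map_mul, Polynomial.map_pow, ha, hh, hf]
    have hdE : p ∣ a ^ 2 * h - f := (dvd_pow_self p (Nat.succ_ne_zero k)).trans ⟨e, he⟩
    -- Newton step for a² h = f: with E = a² h - f and g inverse to f modulo p, the factor 1 - gE/2
    -- turns the error into E(1 - gf) plus a multiple of E². Both are divisible by p^(k+2).
    refine ⟨a * (1 - g * (a ^ 2 * h - f) * C 2⁻¹), ?_, ?_, ?_⟩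
    · generalize a ^ 2 * h - f = E at hE
      simp only [conj] at *
      rw [Polynomial.map_mul, Polynomial.map_sub, Polynomial.map_mul, Polynomial.map_mul, ha, hg,
        hE, hc, Polynomial.map_one]
    · have : a * (1 - g * (a ^ 2 * h - f) * C 2⁻¹) - 1 =
          (a - 1) - (a * g * C 2⁻¹) * (a ^ 2 * h - f) := by ring
      rw [this]
      exact dvd_sub hpa (hdE.mul_left _)
    · have h4 : (a * (1 - g * (a ^ 2 * h - f) * C 2⁻¹)) ^ 2 * h - f =
          (a ^ 2 * h - f) * (1 - g * f) +
            (a ^ 2 * h - f) * (a ^ 2 * h - f) * (-g + g ^ 2 * (a ^ 2 * h) * C 2⁻¹ ^ 2) := by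
        linear_combination (-g * (a ^ 2 * h) * (a ^ 2 * h - f)) * h3
      rw [h4, hq, he]
      refine dvd_add ?_ ?_
      · exact ⟨e * q, by ring⟩
      · refine Dvd.dvd.mul_right ?_ _
        exact ⟨p ^ k * e * e, by ring⟩

/-- M is the Gram matrix of a, b ↦ ell(ab) on 1, …, x^(n-1), so applying M⁻¹ to the values of `l` on
these powers gives the coefficients of h. -/
theorem exists_riesz {Φ : FrobeniusBlock K} {M : Matrix (Fin Φ.size) (Fin Φ.size) K}
    (hM : Φ.IsPhiOne M) (l : K[X] →ₗ[K] K) (hl : ∀ c, l (Φ.chi * c) = 0) :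
    ∃ h, ∀ c, l c = Φ.ell M (c * h) := by
  let z := M⁻¹ *ᵥ fun i : Fin Φ.size => l (X ^ (i : ℕ))
  have hz : M *ᵥ z = fun i : Fin Φ.size => l (X ^ (i : ℕ)) := by
    rw [Matrix.mulVec_mulVec, Matrix.mul_nonsing_inv _ hM.1, Matrix.one_mulVec]
  refine ⟨∑ j : Fin Φ.size, C (z j) * X ^ (j : ℕ), ?_⟩
  have hpow : ∀ i < Φ.size, l (X ^ i) =
      Φ.ell M (X ^ i * ∑ j : Fin Φ.size, C (z j) * X ^ (j : ℕ)) := by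
    intro i hi
    rw [Finset.mul_sum, map_sum]
    refine (congrFun hz ⟨i, hi⟩).symm.trans ?_
    change ∑ j, M ⟨i, hi⟩ j * z j = _
    refine Finset.sum_congr rfl fun j _ => ?_
    rw [mul_left_comm, ← pow_add, ← smul_eq_C_mul, map_smul, smul_eq_mul, mul_comm]
    have := hM.mul_aeval_apply 1 ⟨i, hi⟩ j
    rw [map_one, mul_one, mul_one] at this
    rw [this]
  generalize (∑ j : Fin Φ.size, C (z j) * X ^ (j : ℕ)) = h at hpow
  intro c
  have h1 := modByMonic_add_div c Φ.chi
  have hdeg : (c %ₘ Φ.chi).natDegree < Φ.size :=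
    natDegree_modByMonic_lt _ Φ.chi_monic (fun h1 => Φ.size_pos.ne' (by
      rw [FrobeniusBlock.size, h1]; simp))
  rw [← h1, map_add, hl, add_mul, map_add, mul_assoc, Φ.ell_of_dvd _ (dvd_mul_right _ _),
    (c %ₘ Φ.chi).as_sum_range_C_mul_X_pow' hdeg, map_sum, Finset.sum_mul, map_sum]
  congr 1
  refine Finset.sum_congr rfl fun i hi => ?_
  rw [mul_assoc, ← smul_eq_C_mul, ← smul_eq_C_mul, map_smul, map_smul,
    hpow i (Finset.mem_range.1 hi)]

/-- By Hermitian symmetry h and h̄ represent the same functional, hence so does their average, which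
is self-conjugate. -/
theorem exists_conj_riesz (H : IsPair ε A F) (hε : ε = 1) {Φ : FrobeniusBlock K}
    {M : Matrix (Fin Φ.size) (Fin Φ.size) K}
    (hM : Φ.IsPhiOne M) {v : V} (hv : aeval A Φ.chi v = 0) :
    ∃ h, conj h = h ∧ ∀ c, F v (aeval A c v) = Φ.ell M (c * h) := by
  obtain ⟨h, hh⟩ := exists_riesz hM
    ((F v) ∘ₗ ((LinearMap.applyₗ v) ∘ₗ (aeval A).toLinearMap : K[X] →ₗ[K] V)) fun c => by
      have : aeval A (Φ.chi * c) v = 0 := aeval_of_dvd hv (dvd_mul_right _ _)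
      simpa using congrArg (F v) this
  replace hh : ∀ c, F v (aeval A c v) = Φ.ell M (c * h) := hh
  have hh' : ∀ c, F v (aeval A c v) = Φ.ell M (c * conj h) := by
    intro c
    have h1 : c * conj h = conj (conj c * h) := by
      rw [conj, conj, Polynomial.map_mul]
      congr 1
      exact (conj_conj c).symm
    rw [h1, hM.ell_conj, ← hh, H.herm, hε, one_mul, H.adj']
  refine ⟨C 2⁻¹ * (h + conj h), ?_, fun c => ?_⟩
  · have h1 : conj (C 2⁻¹ * (h + conj h)) = conj (C 2⁻¹) * (conj h + conj (conj h)) := by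
      simp only [conj, Polynomial.map_mul, Polynomial.map_add]
    rw [h1, conj_conj, add_comm, conj_C_half]
  · rw [mul_left_comm, ← smul_eq_C_mul, map_smul, mul_add, map_add, ← hh, ← hh', smul_eq_mul,
      ← two_mul, inv_mul_cancel_left₀ H.two]

/-- The condition `hfv` on the socle says that the polynomial h representing the form of v is
congruent to f modulo p. A self-conjugate a changes h into a² h, and Newton iteration makes this
congruent to f modulo χ. -/
theorem exists_cyclicVector (H : IsPair ε A F) (hε : ε = 1) {Φ : FrobeniusBlock K}
    {M : Matrix (Fin Φ.size) (Fin Φ.size) K} (hM : Φ.IsPhiOne M) {v : V}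
    (hv : aeval A Φ.chi v = 0) {f : K[X]} (hf : conj f = f) (hpf : ¬ Φ.p ∣ f)
    (hfv : ∀ c, F v (aeval A (Φ.p ^ (Φ.m - 1) * c) v) = Φ.ell M (Φ.p ^ (Φ.m - 1) * (c * f))) :
    ∃ a, Φ.p ∣ a - 1 ∧ IsCyclicVector A F Φ (fun c => Φ.ell M (f * c)) (aeval A a v) := by
  obtain ⟨h, hh, hhv⟩ := exists_conj_riesz H hε hM hv
  have hpc : conj Φ.p = Φ.p := FrobeniusBlock.HasPhiOne.map_p ⟨M, hM⟩
  have hd : Φ.p ∣ h - f := hM.p_dvd fun c => by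
    rw [mul_sub, mul_sub, map_sub, ← hfv, hhv, mul_assoc, sub_self]
  obtain ⟨a, ha, hpa, hda⟩ := exists_sq_mul_sub_dvd H.two Φ.irreducible hpc hf hh hpf hd (Φ.m - 1)
  rw [Nat.sub_add_cancel Φ.pos] at hda
  refine ⟨a, hpa, aeval_eq_zero_of_mem_cyc hv (aeval_mem_cyc _ _ _), fun c => ?_⟩
  rw [H.adj', ← aeval_mul_apply, ← aeval_mul_apply, ha, hhv, ← sub_eq_zero, ← map_sub]
  refine Φ.ell_of_dvd _ ?_
  rw [show a * c * a * h - f * c = (a ^ 2 * h - f) * c by ring]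
  exact hda.mul_right c

/-! ### Existence -/

/-- Let μ = p^m r generate the annihilator of U, with p not dividing r. The polynomial e = br is
idempotent modulo μ and projects to the p-primary part. Since μ does not divide p^(m-1) e², some
F(y, p(A)^(m-1) e(A)² x) is nonzero; one e(A) goes to x and the other, as its adjoint ē(A), to y. -/
theorem exists_dual_vectors [FiniteDimensional K V] (H : IsPair ε A F) {U : Submodule K V}
    (hU : ∀ x ∈ U, A x ∈ U) (hnd : NondegOn F U) (hbot : U ≠ ⊥) :
    ∃ Φ : FrobeniusBlock K, ∃ u ∈ U, ∃ w ∈ U, aeval A Φ.chi u = 0 ∧ aeval A Φ.conj.chi w = 0 ∧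
      F w (aeval A (Φ.p ^ (Φ.m - 1)) u) ≠ 0 := by
  let I : Ideal K[X] :=
    { carrier := {g | ∀ x ∈ U, aeval A g x = 0}
      add_mem' := fun ha hb x hx => by rw [map_add, LinearMap.add_apply, ha x hx, hb x hx, add_zero]
      zero_mem' := fun x _ => by simp
      smul_mem' := fun c g hg x hx => by
        rw [smul_eq_mul, aeval_mul_apply, hg x hx, map_zero] }
  have hI : ∀ g, (∀ x ∈ U, aeval A g x = 0) ↔ Submodule.IsPrincipal.generator I ∣ g := by
    intro g
    rw [← Submodule.IsPrincipal.mem_iff_generator_dvd I]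
    rfl
  generalize Submodule.IsPrincipal.generator I = μ at hI
  have hμ0 : μ ≠ 0 := by
    rintro rfl
    have h1 := (hI (minpoly K A)).1 fun x _ => by rw [minpoly.aeval]; rfl
    exact minpoly.ne_zero (Algebra.IsIntegral.isIntegral A) (zero_dvd_iff.1 h1)
  have hμu : ¬ IsUnit μ := by
    intro hu
    refine hbot ((Submodule.eq_bot_iff _).2 fun x hx => ?_)
    have := (hI 1).2 hu.dvd x hx
    simpa using this
  obtain ⟨p, hpm, hp, hpμ⟩ : ∃ p : K[X], p.Monic ∧ Irreducible p ∧ p ∣ μ := by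
    obtain ⟨p, h1, h2, h3⟩ := exists_monic_irreducible_factor μ hμu
    exact ⟨p, h1, h2, h3⟩
  obtain ⟨r, hr, hpr⟩ :=
    (FiniteMultiplicity.of_not_isUnit hp.not_isUnit hμ0).exists_eq_pow_mul_and_not_dvd
  generalize multiplicity p μ = m at hr
  have hm : 0 < m := by
    refine Nat.pos_of_ne_zero fun h0 => hpr ?_
    rw [h0, pow_zero, one_mul] at hr
    exact hr ▸ hpμ
  obtain ⟨a, b, hab⟩ : IsCoprime (p ^ m) r := ((hp.coprime_iff_not_dvd).2 hpr).pow_left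
  have hpb : ¬ p ∣ b := by
    intro h
    have h1 : p ∣ 1 := by
      rw [← hab]
      exact dvd_add ((dvd_pow_self p hm.ne').mul_left a) (h.mul_right r)
    exact hp.not_isUnit (isUnit_of_dvd_one h1)
  have hndvd : ¬ μ ∣ p ^ (m - 1) * (b * r * (b * r)) := by
    intro h
    have h1 : p ^ (m - 1) * p ∣ p ^ (m - 1) * (b * r * (b * r)) := by
      rw [← pow_succ, Nat.sub_add_cancel hm]
      exact (Dvd.intro _ hr.symm).trans h
    have h2 := (mul_dvd_mul_iff_left (pow_ne_zero _ hp.ne_zero)).1 h1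
    rcases hp.prime.dvd_or_dvd h2 with h3 | h3 <;>
      rcases hp.prime.dvd_or_dvd h3 with h4 | h4
    · exact hpb h4
    · exact hpr h4
    · exact hpb h4
    · exact hpr h4
  have hex : ∃ x ∈ U, aeval A (p ^ (m - 1) * (b * r * (b * r))) x ≠ 0 := by
    by_contra! hcon
    exact hndvd ((hI _).1 hcon)
  obtain ⟨x, hx, hx0⟩ := hex
  have hy : ∃ y ∈ U, F y (aeval A (p ^ (m - 1) * (b * r * (b * r))) x) ≠ 0 := by
    by_contra! hcon
    exact hx0 (hnd _ (aeval_mem hU _ x hx) hcon)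
  obtain ⟨y, hy, hy0⟩ := hy
  have hkill : ∀ z ∈ U, aeval A (p ^ m * (b * r)) z = 0 := fun z hz =>
    (hI _).2 (by rw [hr, mul_left_comm]; exact dvd_mul_left _ _) z hz
  refine ⟨⟨p, m, hpm, hp, hm⟩, aeval A (b * r) x, aeval_mem hU _ x hx,
    aeval A (conj (b * r)) y, aeval_mem hU _ y hy, ?_, ?_, ?_⟩
  · rw [← aeval_mul_apply]
    exact hkill x hx
  · rw [FrobeniusBlock.chi_conj, ← aeval_mul_apply,
      show ∀ q, conj q * conj (b * r) = conj (q * (b * r)) from fun q => (Polynomial.map_mul _).symm]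
    -- Vanishing is tested against all z in U: the adjoint of the operator applied to y is (p^m
    -- br)(A), which kills U.
    refine hnd _ (aeval_mem hU _ y hy) fun z hz => H.eq_zero_symm ?_
    rw [H.adj]
    exact (congrArg (F y) (hkill z hz)).trans (map_zero _)
  · rw [H.adj, ← aeval_mul_apply, ← aeval_mul_apply]
    convert hy0 using 4
    change b * r * p ^ (m - 1) * (b * r) = _
    ring

/-- On K[A]u the operator q̄(A) is invertible, so c(A)u lies in its image; moved to the left
argument it becomes q(A), which kills u. -/
theorem isotropic_of_coprime (H : IsPair ε A F) {q : K[X]} {u : V} (hu : aeval A q u = 0)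
    (hc : IsCoprime q (conj q)) (c : K[X]) : F u (aeval A c u) = 0 := by
  obtain ⟨s, t, hst⟩ := hc
  have h1 : aeval A c u = aeval A (conj q) (aeval A (t * c) u) := by
    rw [← aeval_mul_apply]
    have h2 : c = conj q * (t * c) + q * (s * c) := by linear_combination (-c) * hst
    conv_lhs => rw [h2]
    rw [map_add, LinearMap.add_apply, aeval_of_dvd hu (dvd_mul_right q _), add_zero]
  rw [h1, ← H.adj, conj_conj, hu]
  simp

/-- Here ε = -1 and the involution is trivial, so selfadjointness of c(A) makes the value equal to
its own negative. -/
theorem isotropic_of_ne_one (H : IsPair ε A F) (hε : ε ≠ 1) (u : V) (c : K[X]) :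
    F u (aeval A c u) = 0 := by
  obtain ⟨h1, h2⟩ := H.eps_ne hε
  have h3 := H.herm u (aeval A c u)
  rw [h1, h2, H.adj', H.conj_eq hε] at h3
  have h4 : (2 : K) * F u (aeval A c u) = 0 := by linear_combination h3
  exact (mul_eq_zero.1 h4).resolve_left H.two

theorem exists_generates [FiniteDimensional K V] (H : IsPair ε A F)
    (hP : ∀ Φ : FrobeniusBlock K, Φ.HasPhiOne → Φ.IsPhiOne (P Φ)) {U : Submodule K V}
    (hU : ∀ x ∈ U, A x ∈ U) (hnd : NondegOn F U) (hbot : U ≠ ⊥) :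
    ∃ S : Summand K, S.Admissible ε ∧ ∃ U₁ ≤ U, U₁ ≠ ⊥ ∧ Generates P A F S U₁ := by
  obtain ⟨Φ, u, huU, w, hwU, hu, hw, huw⟩ := exists_dual_vectors H hU hnd hbot
  by_cases hcase : ε = 1 ∧ conj Φ.p = Φ.p
  · obtain ⟨hε, hpc⟩ := hcase
    have hΦ := Φ.hasPhiOne_of_conj_p hpc
    have hM := hP Φ hΦ
    have hconj : Φ.conj = Φ := FrobeniusBlock.ext hpc rfl
    rw [hconj] at hw
    have hpp : conj (Φ.p ^ (Φ.m - 1)) = Φ.p ^ (Φ.m - 1) := by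
      rw [conj, Polynomial.map_pow]
      exact congrArg (· ^ _) hpc
    -- Polarization. If all diagonal values vanish, then t = F(w, p(A)^(m-1) u) satisfies ā t + a t̄
    -- = 0 for every a. Taking a = 1 and then some a with ā ≠ a, or using 2 ≠ 0 if the involution is
    -- trivial, gives t = 0.
    have hv : ∃ v ∈ U, aeval A Φ.chi v = 0 ∧ F v (aeval A (Φ.p ^ (Φ.m - 1)) v) ≠ 0 := by
      by_contra! hcon
      have h1 : ∀ a : K, star a * F w (aeval A (Φ.p ^ (Φ.m - 1)) u) +
          a * star (F w (aeval A (Φ.p ^ (Φ.m - 1)) u)) = 0 := by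
        intro a
        have h2 := hcon (a • w + u) (U.add_mem (U.smul_mem a hwU) huU) (by simp [hu, hw])
        have h3 := hcon w hwU hw
        have h4 := hcon u huU hu
        have h5 : F u (aeval A (Φ.p ^ (Φ.m - 1)) w) = star (F w (aeval A (Φ.p ^ (Φ.m - 1)) u)) := by
          rw [H.herm, hε, one_mul, H.adj', hpp]
        simp only [map_add, map_smul, LinearMap.add_apply, LinearMap.map_smulₛₗ,
          LinearMap.smul_apply, h3, h4, h5, smul_eq_mul, starRingEnd_apply, mul_zero, add_zero,
          zero_add] at h2
        rw [add_comm]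
        exact h2
      have h2 := h1 1
      rw [star_one, one_mul, one_mul] at h2
      by_cases hstar : ∃ a : K, star a ≠ a
      · obtain ⟨a, ha⟩ := hstar
        have h3 : (star a - a) * F w (aeval A (Φ.p ^ (Φ.m - 1)) u) = 0 := by
          linear_combination h1 a - a * h2
        exact huw ((mul_eq_zero.1 h3).resolve_left (sub_ne_zero.2 ha))
      · push Not at hstar
        rw [hstar, ← two_mul] at h2
        exact huw ((mul_eq_zero.1 h2).resolve_left H.two)
    obtain ⟨v, hvU, hv, hv0⟩ := hv
    obtain ⟨h, hh, hhv⟩ := exists_conj_riesz H hε hM hv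
    -- The parameter f of the summand is the remainder of h modulo p. It is nonzero because the
    -- diagonal value at v is.
    have hmod : h %ₘ Φ.p - h = Φ.p * (-(h /ₘ Φ.p)) := by
      linear_combination modByMonic_add_div h Φ.p
    have hph : ¬ Φ.p ∣ h := by
      intro hd
      rw [hhv] at hv0
      refine hv0 (Φ.ell_of_dvd _ ?_)
      rw [← Φ.p_pow_mul_p]
      exact mul_dvd_mul_left _ hd
    have hpf : ¬ Φ.p ∣ h %ₘ Φ.p := fun hd => hph ((dvd_sub_right hd).1 (Dvd.intro _ hmod.symm))
    have hfc : conj (h %ₘ Φ.p) = h %ₘ Φ.p := by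
      rw [conj, map_modByMonic _ Φ.monic]
      exact congrArg₂ _ hh hpc
    obtain ⟨a, -, hcyc⟩ := exists_cyclicVector H hε hM hv hfc hpf fun c => by
      rw [hhv, ← sub_eq_zero, ← map_sub]
      refine Φ.ell_of_dvd _ ?_
      rw [← Φ.p_pow_mul_p]
      exact ⟨c * (h /ₘ Φ.p), by linear_combination (-Φ.p ^ (Φ.m - 1) * c) * hmod⟩
    have hf0 : h %ₘ Φ.p ≠ 0 := fun h0 => hpf (h0 ▸ dvd_zero _)
    have hdeg := degree_modByMonic_lt h Φ.monic
    refine ⟨.typeII Φ (h %ₘ Φ.p), ⟨hε, hΦ, hf0, hfc, hdeg⟩,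
      cyc A (aeval A a v), cyc_le hU (aeval_mem hU _ v hvU), ?_, _, hcyc, rfl⟩
    intro h0
    have h1 := (hcyc.hasAnn (hM.chi_dvd_of_mul hf0 hdeg)).finrank_cyc_chi
    rw [h0, finrank_bot] at h1
    exact Φ.size_pos.ne h1
  -- Either ε = 1 and p, p̄ are distinct irreducibles, or ε = -1; the vectors are isotropic for a
  -- different reason in each case.
  · have hiso : ∀ c : K[X], F u (aeval A c u) = 0 ∧ F w (aeval A c w) = 0 := by
      intro c
      by_cases hε : ε = 1
      · have hpc : conj Φ.p ≠ Φ.p := fun h => hcase ⟨hε, h⟩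
        have hc : IsCoprime Φ.chi (conj Φ.chi) := by
          rw [← Φ.chi_conj]
          exact (isCoprime_of_ne Φ.irreducible Φ.conj.irreducible Φ.monic Φ.conj.monic
            (Ne.symm hpc)).pow
        refine ⟨isotropic_of_coprime H hu hc c, isotropic_of_coprime H hw ?_ c⟩
        rw [Φ.chi_conj, conj_conj]
        exact hc.symm
      · exact ⟨isotropic_of_ne_one H hε u c, isotropic_of_ne_one H hε w c⟩
    have hhyp : IsHyperbolicPair A F Φ u w :=
      ⟨hu, hw, fun c => (hiso c).1, fun c => (hiso c).2, 1, by rwa [mul_one]⟩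
    refine ⟨.typeI Φ, fun hε h => hcase ⟨hε, h.map_p⟩, cyc A u ⊔ cyc A w,
      sup_le (cyc_le hU huU) (cyc_le hU hwU), ?_, u, w, hhyp, rfl⟩
    intro h0
    have h1 := hhyp.finrank H
    rw [h0, finrank_bot] at h1
    have := Φ.size_pos
    omega

theorem exists_decomp [FiniteDimensional K V] (H : IsPair ε A F)
    (hP : ∀ Φ : FrobeniusBlock K, Φ.HasPhiOne → Φ.IsPhiOne (P Φ)) (U : Submodule K V)
    (hU : ∀ x ∈ U, A x ∈ U) (hnd : NondegOn F U) :
    ∃ L : List (Summand K), (∀ S ∈ L, S.Admissible ε) ∧ Decomp P A F L U := by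
  induction hn : Module.finrank K U using Nat.strong_induction_on generalizing U with
  | _ n ih =>
    by_cases hbot : U = ⊥
    · exact ⟨[], by simp, hbot⟩
    · obtain ⟨S, hS, U₁, hle, hne, hgen⟩ := exists_generates (P := P) H hP hU hnd hbot
      have hnd1 := hgen.nondegOn H hP hS
      have hfin := finrank_inf_orth hnd1 hle
      have hpos := Submodule.one_le_finrank_iff.2 hne
      obtain ⟨L, hL, hdec⟩ := ih _ (by omega) (U ⊓ orth F U₁)
        (fun x hx => ⟨hU x hx.1, orth_invariant H hgen.invariant x hx.2⟩)
        (nondegOn_inf_orth hnd hnd1 hle) rfl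
      refine ⟨S :: L, ?_, U₁, _, hgen, hdec, fun x hx y hy => hy.2 x hx,
        (sup_orth_eq hnd1 hle).symm⟩
      intro T hT
      rcases List.mem_cons.1 hT with rfl | hT
      · exact hS
      · exact hL T hT

end Existence

/-! ### Uniqueness of the summands of type (i) -/

section TypeOne

/-- Two multisets with the same number of elements in each orbit of an involution are related. -/
theorem multiset_rel_of_count {α : Type*} [DecidableEq α] {τ : α → α} (hτ : Function.Involutive τ)
    {s t : Multiset α}
    (h : ∀ x, s.count x + s.count (τ x) = t.count x + t.count (τ x)) :
    Multiset.Rel (fun x y => y = x ∨ y = τ x) s t := by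
  induction s using Multiset.induction_on generalizing t with
  | empty =>
    have : t = 0 := by
      refine Multiset.eq_zero_of_forall_notMem fun x hx => ?_
      have h1 := h x
      have h2 := Multiset.count_pos.2 hx
      rw [Multiset.count_zero, Multiset.count_zero] at h1
      omega
    rw [this]
    exact Multiset.Rel.zero
  | cons a s ih =>
    have hex : ∃ b ∈ t, b = a ∨ b = τ a := by
      have h1 := h a
      rw [Multiset.count_cons_self] at h1
      by_cases h2 : a ∈ t
      · exact ⟨a, h2, Or.inl rfl⟩
      · rw [Multiset.count_eq_zero.2 h2] at h1
        exact ⟨τ a, Multiset.count_pos.1 (by omega), Or.inr rfl⟩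
    obtain ⟨b, hb, hab⟩ := hex
    obtain ⟨t, rfl⟩ := Multiset.exists_cons_of_mem hb
    refine Multiset.Rel.cons hab (ih fun x => ?_)
    have h1 := h x
    simp only [Multiset.count_cons] at h1
    -- The removed elements a and b lie in one orbit, so every orbit count drops equally on both
    -- sides.
    have h2 : ((if x = a then 1 else 0) + if τ x = a then 1 else 0 : ℕ) =
        (if x = b then 1 else 0) + if τ x = b then 1 else 0 := by
      rcases hab with rfl | rfl
      · rfl
      · rw [add_comm]
        congr 1
        · exact if_congr ⟨fun h => by rw [← h, hτ], fun h => by rw [h, hτ]⟩ rfl rfl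
        · exact if_congr hτ.injective.eq_iff.symm rfl rfl
    omega

variable {K : Type*} [Field K]

section Blocks

variable (L : List (Summand K)) (Φ Ψ : FrobeniusBlock K) (f : K[X])

theorem typeIBlocks_cons_typeI : typeIBlocks (.typeI Φ :: L) = Φ ::ₘ typeIBlocks L := rfl

theorem typeIBlocks_cons_typeII : typeIBlocks (.typeII Φ f :: L) = typeIBlocks L := rfl

theorem typeIIPolys_cons_typeI : typeIIPolys (.typeI Ψ :: L) Φ = typeIIPolys L Φ := rfl

theorem typeIIPolys_cons_self : typeIIPolys (.typeII Φ f :: L) Φ = f :: typeIIPolys L Φ := by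
  simp [typeIIPolys]

variable {Φ Ψ} in
theorem typeIIPolys_cons_of_ne (h : Ψ ≠ Φ) :
    typeIIPolys (.typeII Ψ f :: L) Φ = typeIIPolys L Φ := by
  simp [typeIIPolys, h]

variable {L Φ} in
theorem mem_typeIBlocks : Φ ∈ typeIBlocks L ↔ .typeI Φ ∈ L := by
  induction L with
  | nil => simp [typeIBlocks]
  | cons S L ih =>
    rcases S with Ψ | ⟨Ψ, f⟩
    · rw [typeIBlocks_cons_typeI, Multiset.mem_cons, ih]
      simp
    · rw [typeIBlocks_cons_typeII, ih]
      simp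

variable {L Φ f} in
theorem mem_typeIIPolys : f ∈ typeIIPolys L Φ ↔ .typeII Φ f ∈ L := by
  induction L with
  | nil => simp [typeIIPolys]
  | cons S L ih =>
    rcases S with Ψ | ⟨Ψ, g⟩
    · rw [typeIIPolys_cons_typeI, ih]
      simp
    · by_cases h : Ψ = Φ
      · subst h
        rw [typeIIPolys_cons_self, List.mem_cons, ih]
        simp
      · rw [typeIIPolys_cons_of_ne _ _ h, ih]
        simp [Ne.symm h]

end Blocks

section Multiplicity

variable {V : Type*} [AddCommGroup V] [Module K V]

/-- The cyclic summands with annihilator `χ_Φ` occur in `U` with multiplicity `n`. -/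
def HasMultiplicity (A : Module.End K V) (Φ : FrobeniusBlock K) (U : Submodule K V) (n : ℕ) :
    Prop :=
  Module.finrank K (U.map (aeval A (Φ.p ^ (Φ.m - 1)))) +
      Module.finrank K (U.map (aeval A (Φ.p ^ (Φ.m + 1)))) =
    2 * Module.finrank K (U.map (aeval A (Φ.p ^ Φ.m))) + n * Φ.p.natDegree

variable {A : Module.End K V} {Φ Ψ : FrobeniusBlock K} {U U₁ U₂ : Submodule K V} {n n₁ n₂ : ℕ}

theorem HasMultiplicity.unique (h₁ : HasMultiplicity A Φ U n₁) (h₂ : HasMultiplicity A Φ U n₂) :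
    n₁ = n₂ :=
  Nat.eq_of_mul_eq_mul_right Φ.irreducible.natDegree_pos (Nat.add_left_cancel (h₁.symm.trans h₂))

theorem finrank_map_sup [FiniteDimensional K V] (hd : Disjoint U₁ U₂) (h₁ : ∀ x ∈ U₁, A x ∈ U₁)
    (h₂ : ∀ x ∈ U₂, A x ∈ U₂) (g : K[X]) : Module.finrank K ((U₁ ⊔ U₂).map (aeval A g)) =
      Module.finrank K (U₁.map (aeval A g)) + Module.finrank K (U₂.map (aeval A g)) := by
  have hle : ∀ {U : Submodule K V}, (∀ x ∈ U, A x ∈ U) → U.map (aeval A g) ≤ U := by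
    rintro U hU _ ⟨x, hx, rfl⟩
    exact aeval_mem hU g x hx
  have h3 := Submodule.finrank_sup_add_finrank_inf_eq (U₁.map (aeval A g)) (U₂.map (aeval A g))
  rw [(hd.mono (hle h₁) (hle h₂)).eq_bot, finrank_bot, add_zero] at h3
  rw [Submodule.map_sup, h3]

theorem HasMultiplicity.sup [FiniteDimensional K V] (h₁ : HasMultiplicity A Φ U₁ n₁)
    (h₂ : HasMultiplicity A Φ U₂ n₂) (hd : Disjoint U₁ U₂) (hU₁ : ∀ x ∈ U₁, A x ∈ U₁)
    (hU₂ : ∀ x ∈ U₂, A x ∈ U₂) : HasMultiplicity A Φ (U₁ ⊔ U₂) (n₁ + n₂) := by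
  unfold HasMultiplicity at *
  rw [finrank_map_sup hd hU₁ hU₂, finrank_map_sup hd hU₁ hU₂, finrank_map_sup hd hU₁ hU₂, add_mul]
  omega

theorem hasMultiplicity_bot : HasMultiplicity A Φ ⊥ 0 := by
  rw [HasMultiplicity, Submodule.map_bot, Submodule.map_bot, Submodule.map_bot, finrank_bot]
  simp

-- On K[x]/(p^j) the rank of p^k is max(j - k, 0) deg p; its second difference at k = m is deg p if
-- j = m and zero otherwise. If the annihilator is prime to p, the rank does not depend on k.
open Classical in
theorem HasAnn.hasMultiplicity {v : V} (h : HasAnn A v Ψ.chi) :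
    HasMultiplicity A Φ (cyc A v) (if Ψ = Φ then 1 else 0) := by
  unfold HasMultiplicity
  rw [map_cyc, map_cyc, map_cyc]
  by_cases hp : Ψ.p = Φ.p
  · have h1 : ∀ k, Module.finrank K (cyc A (aeval A (Φ.p ^ k) v)) =
        (Ψ.m - k) * Φ.p.natDegree := by
      intro k
      rw [FrobeniusBlock.chi, hp] at h
      rw [(h.pow_mul Φ.irreducible.ne_zero k).finrank_cyc
        (pow_ne_zero _ Φ.irreducible.ne_zero), natDegree_pow]
    rw [h1, h1, h1, ← add_mul, ← mul_assoc, ← add_mul]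
    congr 1
    have := Φ.pos
    by_cases hm : Ψ.m = Φ.m
    · rw [if_pos (FrobeniusBlock.ext hp hm)]
      omega
    · rw [if_neg fun h => hm (congrArg _ h)]
      omega
  · have h1 : ∀ k, Module.finrank K (cyc A (aeval A (Φ.p ^ k) v)) = Ψ.size := fun k =>
      (h.coprime_mul (isCoprime_of_ne Ψ.irreducible Φ.irreducible Ψ.monic Φ.monic
        hp).pow).finrank_cyc_chi
    rw [h1, h1, h1, if_neg fun h => hp (congrArg _ h)]
    omega

end Multiplicity

variable [StarRing K]

theorem FrobeniusBlock.HasPhiOne.conj_eq {Φ : FrobeniusBlock K} (h : Φ.HasPhiOne) : Φ.conj = Φ :=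
  FrobeniusBlock.ext h.map_p rfl

variable {V : Type*} [AddCommGroup V] [Module K V]
  {ε : K} {A : Module.End K V} {F : V →ₗ⋆[K] V →ₗ[K] K}
  {P : (Φ : FrobeniusBlock K) → Matrix (Fin Φ.size) (Fin Φ.size) K}
  {L L' : List (Summand K)} {U : Submodule K V}

-- A type (i) summand with block Ψ contributes the cyclic modules of both Ψ and its conjugate, twice
-- the same one if Ψ is self-conjugate. A type (ii) summand contributes one.
open Classical in
theorem Decomp.hasMultiplicity [FiniteDimensional K V] (H : IsPair ε A F)
    (hP : ∀ Φ : FrobeniusBlock K, Φ.HasPhiOne → Φ.IsPhiOne (P Φ))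
    (hL : ∀ S ∈ L, S.Admissible ε) (h : Decomp P A F L U) (Φ : FrobeniusBlock K) :
    HasMultiplicity A Φ U ((typeIBlocks L).count Φ + (typeIBlocks L).count Φ.conj +
      (typeIIPolys L Φ).length) := by
  induction L generalizing U with
  | nil =>
    have h0 : U = ⊥ := h
    rw [h0]
    exact hasMultiplicity_bot
  | cons S L ih =>
    obtain ⟨U₁, U₂, h1, h2, ho, rfl⟩ := h
    have hS := hL S (by simp)
    have ih := ih (fun S hS => hL S (by simp [hS])) h2
    have hd := (h1.nondegOn H hP hS).disjoint ho
    have hsup := fun n (hn : HasMultiplicity A Φ U₁ n) => hn.sup ih hd h1.invariant h2.invariant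
    rcases S with Ψ | ⟨Ψ, f⟩
    · obtain ⟨v, w, hvw, rfl⟩ := h1
      have h3 := hvw.hasAnn.hasMultiplicity (Φ := Φ)
      have h4 := (hvw.swap H).hasAnn.hasMultiplicity (Φ := Φ)
      convert hsup _ (h3.sup h4 (hvw.disjoint H) (cyc_invariant A v) (cyc_invariant A w)) using 1
      rw [typeIBlocks_cons_typeI, typeIIPolys_cons_typeI, Multiset.count_cons, Multiset.count_cons]
      have h5 : Φ.conj = Ψ ↔ Ψ.conj = Φ :=
        ⟨fun h => by rw [← h, Φ.conj_involutive], fun h => by rw [← h, Ψ.conj_involutive]⟩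
      rw [if_congr h5 rfl rfl, if_congr (eq_comm (a := Φ)) rfl rfl]
      ring
    · obtain ⟨v, hv, rfl⟩ := h1
      obtain ⟨-, hΨ, hf, -, hdeg⟩ := hS
      have h3 := (hv.hasAnn ((hP Ψ hΨ).chi_dvd_of_mul hf hdeg)).hasMultiplicity (Φ := Φ)
      convert hsup _ h3 using 1
      rw [typeIBlocks_cons_typeII]
      by_cases hΨΦ : Ψ = Φ
      · subst hΨΦ
        rw [typeIIPolys_cons_self, if_pos rfl, List.length_cons]
        ring
      · rw [typeIIPolys_cons_of_ne _ _ hΨΦ, if_neg hΨΦ, zero_add]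

theorem typeIIPolys_eq_nil (hL : ∀ S ∈ L, S.Admissible ε) {Φ : FrobeniusBlock K}
    (h : ε ≠ 1 ∨ ¬ Φ.HasPhiOne) : typeIIPolys L Φ = [] := by
  refine List.eq_nil_iff_forall_not_mem.2 fun f hf => ?_
  have h1 := hL _ (mem_typeIIPolys.1 hf)
  exact h.elim (fun h => h h1.1) fun h => h h1.2.1

/-- The two types never compete for the same Φ. If ε = 1 and Φ₁ exists, admissibility excludes type
(i); otherwise there is no type (ii), and the multiplicity counts the orbit of Φ under conjugation.
-/
theorem Decomp.typeIBlocks_rel [FiniteDimensional K V] (H : IsPair ε A F)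
    (hP : ∀ Φ : FrobeniusBlock K, Φ.HasPhiOne → Φ.IsPhiOne (P Φ))
    (hL : ∀ S ∈ L, S.Admissible ε) (hL' : ∀ S ∈ L', S.Admissible ε) (h : Decomp P A F L U)
    (h' : Decomp P A F L' U) :
    Multiset.Rel (fun Φ Ψ => Ψ.chi = Φ.chi ∨ Ψ.chi = Φ.chi.map (starRingEnd K))
      (typeIBlocks L) (typeIBlocks L') := by
  classical
  have h1 : Multiset.Rel (fun Φ Ψ => Ψ = Φ ∨ Ψ = Φ.conj) (typeIBlocks L) (typeIBlocks L') := by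
    refine multiset_rel_of_count FrobeniusBlock.conj_involutive fun Φ => ?_
    have h2 := (h.hasMultiplicity H hP hL Φ).unique (h'.hasMultiplicity H hP hL' Φ)
    by_cases hc : ε ≠ 1 ∨ ¬ Φ.HasPhiOne
    · simpa only [typeIIPolys_eq_nil hL hc, typeIIPolys_eq_nil hL' hc, List.length_nil, add_zero]
        using h2
    · push Not at hc
      have h3 : ∀ M : List (Summand K), (∀ S ∈ M, S.Admissible ε) →
          (typeIBlocks M).count Φ = 0 := fun M hM =>
        Multiset.count_eq_zero.2 fun hmem => hM _ (mem_typeIBlocks.1 hmem) hc.1 hc.2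
      rw [hc.2.conj_eq, h3 L hL, h3 L' hL']
  refine h1.mono fun Φ _ Ψ _ h => ?_
  rcases h with rfl | rfl
  · exact Or.inl rfl
  · exact Or.inr Φ.chi_conj

end TypeOne

/-! ### Hermitian forms over K[ω] and uniqueness of the summands of type (ii) -/

section Layers

section DiagForm

variable {R : Type*} [CommRing R] (σ : R →+* R)

theorem diagForm_cons (f : R) (a : List R) (x y : Fin (f :: a).length → R) :
    diagForm σ (f :: a) x y =
      σ (x 0) * f * y 0 + diagForm σ a (fun i => x i.succ) (fun i => y i.succ) :=
  Fin.sum_univ_succ _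

variable (a : List R)

theorem diagForm_add_right (x y z : Fin a.length → R) :
    diagForm σ a x (y + z) = diagForm σ a x y + diagForm σ a x z := by
  simp [diagForm, mul_add, Finset.sum_add_distrib]

theorem diagForm_smul_right (r : R) (x y : Fin a.length → R) :
    diagForm σ a x (r • y) = r * diagForm σ a x y := by
  simp only [diagForm, Finset.mul_sum, Pi.smul_apply, smul_eq_mul]
  exact Finset.sum_congr rfl fun i _ => by ring

theorem diagForm_single_left (i : Fin a.length) (y : Fin a.length → R) :
    diagForm σ a (Pi.single i 1) y = a.get i * y i := by
  rw [diagForm, Finset.sum_eq_single i]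
  · simp
  · intro j _ hj
    simp [hj]
  · simp

variable {a} in
theorem eq_of_diagForm_eq [IsDomain R] (ha : ∀ r ∈ a, r ≠ 0) {y z : Fin a.length → R}
    (h : ∀ x, diagForm σ a x y = diagForm σ a x z) : y = z := by
  ext i
  have h1 := h (Pi.single i 1)
  rw [diagForm_single_left, diagForm_single_left] at h1
  exact mul_left_cancel₀ (ha _ (a.get_mem i)) h1

end DiagForm

variable {K : Type*} [Field K]

namespace FrobeniusBlock

/-- The functional on `K[ω]` induced by the functional of `Φ₁` on the socle. -/
def ellBar (Φ : FrobeniusBlock K) (M : Matrix (Fin Φ.size) (Fin Φ.size) K) :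
    AdjoinRoot Φ.p →ₗ[K] K :=
  Φ.ell M ∘ₗ LinearMap.mulLeft K (Φ.p ^ (Φ.m - 1)) ∘ₗ AdjoinRoot.modByMonicHom Φ.monic

theorem ellBar_mk (Φ : FrobeniusBlock K) (M : Matrix (Fin Φ.size) (Fin Φ.size) K) (g : K[X]) :
    Φ.ellBar M (AdjoinRoot.mk Φ.p g) = Φ.ell M (Φ.p ^ (Φ.m - 1) * g) := by
  change Φ.ell M (Φ.p ^ (Φ.m - 1) * AdjoinRoot.modByMonicHom Φ.monic (AdjoinRoot.mk Φ.p g)) = _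
  rw [AdjoinRoot.modByMonicHom_mk, ← sub_eq_zero, ← map_sub]
  refine Φ.ell_of_dvd _ ?_
  rw [← Φ.p_pow_mul_p]
  exact ⟨-(g /ₘ Φ.p), by linear_combination Φ.p ^ (Φ.m - 1) * modByMonic_add_div g Φ.p⟩

variable [StarRing K] {Φ : FrobeniusBlock K} {M : Matrix (Fin Φ.size) (Fin Φ.size) K}

/-- The functional on K[ω] plays the role of a nondegenerate trace: a K[ω]-valued form is determined
by its K-valued image. -/
theorem IsPhiOne.eq_zero_of_ellBar (hM : Φ.IsPhiOne M) {x : AdjoinRoot Φ.p}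
    (h : ∀ c, Φ.ellBar M (AdjoinRoot.mk Φ.p c * x) = 0) : x = 0 := by
  obtain ⟨g, rfl⟩ := AdjoinRoot.mk_surjective x
  rw [AdjoinRoot.mk_eq_zero]
  refine hM.p_dvd fun c => ?_
  rw [← ellBar_mk, map_mul, h]

theorem IsPhiOne.eq_of_ellBar (hM : Φ.IsPhiOne M) {x y : AdjoinRoot Φ.p}
    (h : ∀ c, Φ.ellBar M (AdjoinRoot.mk Φ.p c * x) = Φ.ellBar M (AdjoinRoot.mk Φ.p c * y)) :
    x = y :=
  sub_eq_zero.1 (hM.eq_zero_of_ellBar fun c => by rw [mul_sub, map_sub, h, sub_self])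

theorem involution_mk (h : Φ.HasPhiOne) (g : K[X]) :
    Φ.involution h (AdjoinRoot.mk Φ.p g) = AdjoinRoot.mk Φ.p (SelfadjointOperator.conj g) := by
  rw [involution, AdjoinRoot.map, AdjoinRoot.lift_mk, ← eval₂_map, ← AdjoinRoot.aeval_eq]
  rfl

omit [StarRing K] in
theorem isDomain_adjoinRoot (Φ : FrobeniusBlock K) : IsDomain (AdjoinRoot Φ.p) :=
  AdjoinRoot.isDomain_of_prime Φ.irreducible.prime

end FrobeniusBlock

variable [StarRing K] {V : Type*} [AddCommGroup V] [Module K V]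

/-- The map `ρ` identifies the form `F(u, p(A) ^ (m - 1) v)` on the vectors of `U` annihilated by
`p(A) ^ m`, modulo its radical, with the diagonal form `a` over `K[ω]`. -/
structure IsLayerMap (A : Module.End K V) (F : V →ₗ⋆[K] V →ₗ[K] K) {Φ : FrobeniusBlock K}
    (M : Matrix (Fin Φ.size) (Fin Φ.size) K) (h : Φ.HasPhiOne) (U : Submodule K V)
    (a : List (AdjoinRoot Φ.p)) (ρ : V → Fin a.length → AdjoinRoot Φ.p) : Prop where
  form : ∀ u ∈ U, ∀ v ∈ U, aeval A Φ.chi u = 0 → aeval A Φ.chi v = 0 → ∀ c,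
    F u (aeval A (Φ.p ^ (Φ.m - 1) * c) v) =
      Φ.ellBar M (AdjoinRoot.mk Φ.p c * diagForm (Φ.involution h) a (ρ u) (ρ v))
  surj : ∀ x, ∃ u ∈ U, aeval A Φ.chi u = 0 ∧ ρ u = x

variable {ε : K} {A : Module.End K V} {F : V →ₗ⋆[K] V →ₗ[K] K}
  {P : (Φ : FrobeniusBlock K) → Matrix (Fin Φ.size) (Fin Φ.size) K}
  {L L' : List (Summand K)} {U U₁ U₂ : Submodule K V} {Φ : FrobeniusBlock K}
  {M : Matrix (Fin Φ.size) (Fin Φ.size) K} {h : Φ.HasPhiOne}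

namespace IsLayerMap

variable {a b : List (AdjoinRoot Φ.p)} {ρ : V → Fin a.length → AdjoinRoot Φ.p}
  {ρ' : V → Fin b.length → AdjoinRoot Φ.p}

/-- `ρ` is an arbitrary function in `IsLayerMap`. On the vectors of U killed by χ(A) its values are
forced by pairings, and additivity and K[ω]-linearity follow from this. -/
theorem eq_of_forall (hM : Φ.IsPhiOne M) (ha : ∀ r ∈ a, r ≠ 0) (hρ : IsLayerMap A F M h U a ρ)
    {u : V} (hu : u ∈ U) (hu0 : aeval A Φ.chi u = 0) {x : Fin a.length → AdjoinRoot Φ.p}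
    (hx : ∀ s ∈ U, aeval A Φ.chi s = 0 → ∀ c, F s (aeval A (Φ.p ^ (Φ.m - 1) * c) u) =
      Φ.ellBar M (AdjoinRoot.mk Φ.p c * diagForm (Φ.involution h) a (ρ s) x)) : ρ u = x := by
  have := Φ.isDomain_adjoinRoot
  refine eq_of_diagForm_eq (Φ.involution h) ha fun y => ?_
  obtain ⟨s, hs, hs0, rfl⟩ := hρ.surj y
  exact hM.eq_of_ellBar fun c => by rw [← hρ.form s hs u hu hs0 hu0, hx s hs hs0]

theorem map_add_eq (hM : Φ.IsPhiOne M) (ha : ∀ r ∈ a, r ≠ 0) (hρ : IsLayerMap A F M h U a ρ)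
    {u v : V} (hu : u ∈ U) (hu0 : aeval A Φ.chi u = 0) (hv : v ∈ U) (hv0 : aeval A Φ.chi v = 0) :
    ρ (u + v) = ρ u + ρ v := by
  refine hρ.eq_of_forall hM ha (U.add_mem hu hv) (by rw [map_add, hu0, hv0, add_zero])
    fun s hs hs0 c => ?_
  rw [diagForm_add_right, mul_add, map_add, map_add, map_add,
    hρ.form s hs u hu hs0 hu0, hρ.form s hs v hv hs0 hv0]

theorem map_aeval (hM : Φ.IsPhiOne M) (ha : ∀ r ∈ a, r ≠ 0) (hρ : IsLayerMap A F M h U a ρ)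
    (hU : ∀ x ∈ U, A x ∈ U) {u : V} (hu : u ∈ U) (hu0 : aeval A Φ.chi u = 0) (g : K[X]) :
    ρ (aeval A g u) = AdjoinRoot.mk Φ.p g • ρ u := by
  refine hρ.eq_of_forall hM ha (aeval_mem hU g u hu) (by rw [aeval_comm_apply, hu0, map_zero])
    fun s hs hs0 c => ?_
  rw [diagForm_smul_right, ← aeval_mul_apply, mul_assoc, hρ.form s hs u hu hs0 hu0,
    map_mul (AdjoinRoot.mk Φ.p), mul_assoc]

theorem eq_iff (hM : Φ.IsPhiOne M) (ha : ∀ r ∈ a, r ≠ 0) (hρ : IsLayerMap A F M h U a ρ)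
    {u v : V} (hu : u ∈ U) (hu0 : aeval A Φ.chi u = 0) (hv : v ∈ U) (hv0 : aeval A Φ.chi v = 0) :
    ρ u = ρ v ↔ ∀ s ∈ U, aeval A Φ.chi s = 0 → ∀ c, F s (aeval A (Φ.p ^ (Φ.m - 1) * c) u) =
      F s (aeval A (Φ.p ^ (Φ.m - 1) * c) v) := by
  constructor
  · intro huv s hs hs0 c
    rw [hρ.form s hs u hu hs0 hu0, hρ.form s hs v hv hs0 hv0, huv]
  · intro huv
    refine hρ.eq_of_forall hM ha hu hu0 fun s hs hs0 c => ?_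
    rw [huv s hs hs0, hρ.form s hs v hv hs0 hv0]

/-- Lift through `ρ` and project by `ρ'`. By `eq_iff` both maps identify the same vectors, those
equal modulo the radical, so the result does not depend on the lift. -/
theorem diagFormEquiv (hM : Φ.IsPhiOne M) (hU : ∀ x ∈ U, A x ∈ U) (ha : ∀ r ∈ a, r ≠ 0)
    (hb : ∀ r ∈ b, r ≠ 0) (hρ : IsLayerMap A F M h U a ρ) (hρ' : IsLayerMap A F M h U b ρ') :
    DiagFormEquiv (Φ.involution h) a b := by
  choose t htU ht0 ht using hρ.surj
  choose t' htU' ht0' ht' using hρ'.surj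
  have h1 : ∀ u ∈ U, aeval A Φ.chi u = 0 → ρ' (t (ρ u)) = ρ' u := fun u hu hu0 =>
    (hρ'.eq_iff hM hb (htU _) (ht0 _) hu hu0).2
      ((hρ.eq_iff hM ha (htU _) (ht0 _) hu hu0).1 (ht _))
  have h2 : ∀ u ∈ U, aeval A Φ.chi u = 0 → ρ (t' (ρ' u)) = ρ u := fun u hu hu0 =>
    (hρ.eq_iff hM ha (htU' _) (ht0' _) hu hu0).2
      ((hρ'.eq_iff hM hb (htU' _) (ht0' _) hu hu0).1 (ht' _))
  refine ⟨{
    toFun := fun x => ρ' (t x)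
    invFun := fun y => ρ (t' y)
    map_add' := ?_
    map_smul' := ?_
    left_inv := ?_
    right_inv := ?_ }, ?_⟩
  · intro x y
    rw [← hρ'.map_add_eq hM hb (htU x) (ht0 x) (htU y) (ht0 y),
      ← h1 _ (U.add_mem (htU x) (htU y)) (by rw [map_add, ht0, ht0, add_zero]),
      hρ.map_add_eq hM ha (htU x) (ht0 x) (htU y) (ht0 y), ht, ht]
  · intro r x
    obtain ⟨g, rfl⟩ := AdjoinRoot.mk_surjective r
    rw [RingHom.id_apply, ← hρ'.map_aeval hM hb hU (htU x) (ht0 x),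
      ← h1 _ (aeval_mem hU g _ (htU x)) (by rw [aeval_comm_apply, ht0, map_zero]),
      hρ.map_aeval hM ha hU (htU x) (ht0 x), ht]
  · intro x
    exact (h2 _ (htU x) (ht0 x)).trans (ht x)
  · intro y
    exact (h1 _ (htU' y) (ht0' y)).trans (ht' y)
  · intro x y
    refine hM.eq_of_ellBar fun c => ?_
    have h3 := hρ.form _ (htU x) _ (htU y) (ht0 x) (ht0 y) c
    rw [ht, ht] at h3
    rw [← h3]
    exact (hρ'.form _ (htU x) _ (htU y) (ht0 x) (ht0 y) c).symm

theorem of_diagFormEquiv (hρ : IsLayerMap A F M h U a ρ)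
    (hab : DiagFormEquiv (Φ.involution h) a b) : ∃ ρ', IsLayerMap A F M h U b ρ' := by
  obtain ⟨e, he⟩ := hab
  refine ⟨fun v => e (ρ v), ⟨fun u hu v hv hu0 hv0 c => ?_, fun x => ?_⟩⟩
  · rw [he, hρ.form u hu v hv hu0 hv0]
  · obtain ⟨u, hu, hu0, hx⟩ := hρ.surj (e.symm x)
    exact ⟨u, hu, hu0, by rw [hx, e.apply_symm_apply]⟩

end IsLayerMap

omit [StarRing K] in
theorem aeval_eq_zero_of_add (hd : Disjoint U₁ U₂) (h₁ : ∀ x ∈ U₁, A x ∈ U₁)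
    (h₂ : ∀ x ∈ U₂, A x ∈ U₂) {g : K[X]} {x y : V} (hx : x ∈ U₁) (hy : y ∈ U₂)
    (hxy : aeval A g (x + y) = 0) : aeval A g x = 0 ∧ aeval A g y = 0 := by
  rw [map_add] at hxy
  have h3 : aeval A g x = 0 := Submodule.disjoint_def.1 hd _ (aeval_mem h₁ g x hx) (by
    rw [eq_neg_of_add_eq_zero_left hxy]
    exact U₂.neg_mem (aeval_mem h₂ g y hy))
  exact ⟨h3, by rwa [h3, zero_add] at hxy⟩

/-- The layer map of an orthogonal sum whose first term does not contribute. -/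
theorem IsLayerMap.sup_of_eq_zero (H : IsPair ε A F) (ho : ∀ x ∈ U₁, ∀ y ∈ U₂, F x y = 0)
    (hd : Disjoint U₁ U₂) (h₁ : ∀ x ∈ U₁, A x ∈ U₁) (h₂ : ∀ x ∈ U₂, A x ∈ U₂)
    (h0 : ∀ u ∈ U₁, ∀ v ∈ U₁, aeval A Φ.chi u = 0 → aeval A Φ.chi v = 0 → ∀ c,
      F u (aeval A (Φ.p ^ (Φ.m - 1) * c) v) = 0)
    {a : List (AdjoinRoot Φ.p)} {ρ : V → Fin a.length → AdjoinRoot Φ.p}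
    (hρ : IsLayerMap A F M h U₂ a ρ) : ∃ ρ', IsLayerMap A F M h (U₁ ⊔ U₂) a ρ' := by
  have hdec : ∀ u ∈ U₁ ⊔ U₂, ∃ v, v ∈ U₂ ∧ u - v ∈ U₁ := by
    intro u hu
    obtain ⟨x, hx, y, hy, rfl⟩ := Submodule.mem_sup.1 hu
    exact ⟨y, hy, by simpa using hx⟩
  choose! s hs hs' using hdec
  have hs0 : ∀ u ∈ U₁ ⊔ U₂, aeval A Φ.chi u = 0 →
      aeval A Φ.chi (u - s u) = 0 ∧ aeval A Φ.chi (s u) = 0 := fun u hu hu0 =>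
    aeval_eq_zero_of_add hd h₁ h₂ (hs' u hu) (hs u hu) (by rwa [sub_add_cancel])
  refine ⟨fun u => ρ (s u), ⟨fun u hu v hv hu0 hv0 c => ?_, fun x => ?_⟩⟩
  · rw [← hρ.form _ (hs u hu) _ (hs v hv) (hs0 u hu hu0).2 (hs0 v hv hv0).2]
    have e1 := h0 _ (hs' u hu) _ (hs' v hv) (hs0 u hu hu0).1 (hs0 v hv hv0).1 c
    have e2 := ho _ (hs' u hu) _ (aeval_mem h₂ (Φ.p ^ (Φ.m - 1) * c) _ (hs v hv))
    have e3 := H.eq_zero_symm (ho _ (aeval_mem h₁ (Φ.p ^ (Φ.m - 1) * c) _ (hs' v hv)) _ (hs u hu))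
    simp only [map_sub, LinearMap.sub_apply] at e1 e2 e3
    linear_combination e1 + e2 + e3
  · obtain ⟨u, hu, hu0, rfl⟩ := hρ.surj x
    have hu' : u ∈ U₁ ⊔ U₂ := Submodule.mem_sup_right hu
    refine ⟨u, hu', hu0, ?_⟩
    have : u - s u = 0 :=
      Submodule.disjoint_def.1 hd _ (hs' u hu') (U₂.sub_mem hu (hs u hu'))
    rw [← sub_eq_zero.1 this]

theorem IsCyclicVector.layer_form (H : IsPair ε A F) (h : Φ.HasPhiOne) {v : V} {f : K[X]}
    (hv : IsCyclicVector A F Φ (fun c => Φ.ell M (f * c)) v) (a b c : K[X]) :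
    F (aeval A a v) (aeval A (Φ.p ^ (Φ.m - 1) * c) (aeval A b v)) =
      Φ.ellBar M (AdjoinRoot.mk Φ.p c * (Φ.involution h (AdjoinRoot.mk Φ.p a) *
        AdjoinRoot.mk Φ.p f * AdjoinRoot.mk Φ.p b)) := by
  rw [← aeval_mul_apply, hv.form_eq H, FrobeniusBlock.involution_mk,
    ← map_mul (AdjoinRoot.mk Φ.p), ← map_mul (AdjoinRoot.mk Φ.p),
    ← map_mul (AdjoinRoot.mk Φ.p), Φ.ellBar_mk]
  exact congrArg (Φ.ell M) (by ring)

/-- The layer map of an orthogonal sum whose first term is a cyclic summand. -/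
theorem IsLayerMap.sup_cons (H : IsPair ε A F)
    {v : V} {f : K[X]} (hv : IsCyclicVector A F Φ (fun c => Φ.ell M (f * c)) v)
    (hann : HasAnn A v Φ.chi) (ho : ∀ x ∈ cyc A v, ∀ y ∈ U₂, F x y = 0)
    (hd : Disjoint (cyc A v) U₂) (h₂ : ∀ x ∈ U₂, A x ∈ U₂)
    {a : List (AdjoinRoot Φ.p)} {ρ : V → Fin a.length → AdjoinRoot Φ.p}
    (hρ : IsLayerMap A F M h U₂ a ρ) :
    ∃ ρ', IsLayerMap A F M h (cyc A v ⊔ U₂) (AdjoinRoot.mk Φ.p f :: a) ρ' := by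
  have hdec : ∀ u ∈ cyc A v ⊔ U₂, ∃ g : K[X], u - aeval A g v ∈ U₂ := by
    intro u hu
    obtain ⟨x, hx, y, hy, rfl⟩ := Submodule.mem_sup.1 hu
    obtain ⟨g, rfl⟩ := mem_cyc.1 hx
    exact ⟨g, by simpa using hy⟩
  choose! s hs using hdec
  have hs0 : ∀ u ∈ cyc A v ⊔ U₂, aeval A Φ.chi u = 0 →
      aeval A Φ.chi (u - aeval A (s u) v) = 0 := fun u hu hu0 =>
    (aeval_eq_zero_of_add hd (cyc_invariant A v) h₂ (aeval_mem_cyc A v (s u)) (hs u hu)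
      (by rwa [add_sub_cancel])).2
  refine ⟨fun u => Fin.cons (AdjoinRoot.mk Φ.p (s u)) (ρ (u - aeval A (s u) v)),
    ⟨fun u hu w hw hu0 hw0 c => ?_, fun x => ?_⟩⟩
  · have e0 := hρ.form _ (hs u hu) _ (hs w hw) (hs0 u hu hu0) (hs0 w hw hw0) c
    have e1 := hv.layer_form H h (s u) (s w) c
    have e2 := ho _ (aeval_mem_cyc A v (s u)) _
      (aeval_mem h₂ (Φ.p ^ (Φ.m - 1) * c) _ (hs w hw))
    have e3 := H.eq_zero_symm (ho _ (aeval_mem (cyc_invariant A v) (Φ.p ^ (Φ.m - 1) * c) _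
      (aeval_mem_cyc A v (s w))) _ (hs u hu))
    rw [diagForm_cons, mul_add, map_add]
    change _ = Φ.ellBar M (AdjoinRoot.mk Φ.p c * (Φ.involution h (AdjoinRoot.mk Φ.p (s u)) *
          AdjoinRoot.mk Φ.p f * AdjoinRoot.mk Φ.p (s w))) +
      Φ.ellBar M (AdjoinRoot.mk Φ.p c * diagForm (Φ.involution h) a
        (ρ (u - aeval A (s u) v)) (ρ (w - aeval A (s w) v)))
    rw [← e1, ← e0]
    generalize aeval A (s u) v = u' at *
    generalize aeval A (s w) v = w' at *
    generalize aeval A (Φ.p ^ (Φ.m - 1) * c) = B at *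
    simp only [map_sub, LinearMap.sub_apply] at e2 e3 ⊢
    linear_combination e2 + e3
  · obtain ⟨u, hu, hu0, hux⟩ := hρ.surj fun i => x i.succ
    obtain ⟨g, hg⟩ := AdjoinRoot.mk_surjective (x 0)
    have hmem : aeval A g v + u ∈ cyc A v ⊔ U₂ := Submodule.add_mem_sup (aeval_mem_cyc A v g) hu
    -- The chosen coefficient `s` need not return g, but the difference annihilates v. It is
    -- therefore a multiple of χ and vanishes in K[ω].
    have h3 : aeval A (g - s (aeval A g v + u)) v = 0 := by
      refine Submodule.disjoint_def.1 hd _ (aeval_mem_cyc _ _ _) ?_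
      have := U₂.sub_mem (hs _ hmem) hu
      rw [map_sub, LinearMap.sub_apply]
      convert this using 1
      abel
    refine ⟨aeval A g v + u, hmem, ?_, ?_⟩
    · rw [map_add, hu0, add_zero, aeval_comm_apply, hv.ann, map_zero]
    · have h4 : AdjoinRoot.mk Φ.p (s (aeval A g v + u)) = x 0 := by
        rw [← hg, eq_comm, AdjoinRoot.mk_eq_mk]
        refine (dvd_pow_self Φ.p Φ.pos.ne').trans ?_
        exact (hann _).1 h3
      have h5 : aeval A g v + u - aeval A (s (aeval A g v + u)) v = u := by
        rw [map_sub, LinearMap.sub_apply] at h3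
        rw [add_sub_right_comm, h3, zero_add]
      rw [h4, h5, hux]
      exact Fin.cons_self_tail x

/-- A summand prime to p contains no nonzero vector killed by χ_Φ. On K[x]/(p^j) with j < m the
factor p^(m-1) already acts as zero. If j > m, a vector killed by p^m is divisible by p, and moving
this p across F completes p^m on the other vector. -/
theorem Generates.form_eq_zero (H : IsPair ε A F) (hε : ε = 1)
    (hP : ∀ Φ : FrobeniusBlock K, Φ.HasPhiOne → Φ.IsPhiOne (P Φ)) (hΦ : Φ.HasPhiOne) {S : Summand K}
    (hS : S.Admissible ε) (hne : ∀ f, S ≠ .typeII Φ f) (hgen : Generates P A F S U) {u w : V}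
    (hu : u ∈ U) (hw : w ∈ U) (hu0 : aeval A Φ.chi u = 0) (hw0 : aeval A Φ.chi w = 0) (c : K[X]) :
    F u (aeval A (Φ.p ^ (Φ.m - 1) * c) w) = 0 := by
  rcases S with Ψ | ⟨Ψ, f⟩
  · obtain ⟨v, z, hvz, rfl⟩ := hgen
    suffices u = 0 by rw [this]; simp
    have hΨ : SelfadjointOperator.conj Ψ.p ≠ Ψ.p := fun h => hS hε (Ψ.hasPhiOne_of_conj_p h)
    have hΦp : SelfadjointOperator.conj Φ.p = Φ.p := hΦ.map_p
    have h1 : Φ.p ≠ Ψ.p := fun h => hΨ (by rw [← h, hΦp])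
    have h2 : Φ.p ≠ Ψ.conj.p := fun h => h1 (by
      rw [← hΦp, h]; exact conj_conj _)
    have hc : IsCoprime Φ.chi (Ψ.chi * Ψ.conj.chi) :=
      (isCoprime_of_ne Φ.irreducible Ψ.irreducible Φ.monic Ψ.monic h1).pow.mul_right
        (isCoprime_of_ne Φ.irreducible Ψ.conj.irreducible Φ.monic Ψ.conj.monic h2).pow
    refine eq_zero_of_coprime hu0 ?_ hc
    obtain ⟨x, hx, y, hy, rfl⟩ := Submodule.mem_sup.1 hu
    rw [map_add, aeval_of_dvd (aeval_eq_zero_of_mem_cyc hvz.ann_left hx) (dvd_mul_right _ _),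
      aeval_of_dvd (aeval_eq_zero_of_mem_cyc hvz.ann_right hy) (dvd_mul_left _ _), add_zero]
  · obtain ⟨v, hv, rfl⟩ := hgen
    obtain ⟨-, hΨ, hf, -, hdeg⟩ := hS
    have hann := hv.hasAnn ((hP Ψ hΨ).chi_dvd_of_mul hf hdeg)
    by_cases hp : Ψ.p = Φ.p
    · have hm : Ψ.m ≠ Φ.m := fun hm => hne f (by rw [FrobeniusBlock.ext hp hm])
      obtain ⟨a, rfl⟩ := mem_cyc.1 hu
      obtain ⟨b, rfl⟩ := mem_cyc.1 hw
      rw [← aeval_mul_apply] at hu0 hw0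
      rw [H.adj', ← aeval_mul_apply, ← aeval_mul_apply]
      rw [hann] at hu0 hw0
      suffices Ψ.chi ∣ conj a * (Φ.p ^ (Φ.m - 1) * c) * b by rw [(hann _).2 this, map_zero]
      rw [FrobeniusBlock.chi, hp, FrobeniusBlock.chi] at hu0 hw0
      rw [FrobeniusBlock.chi, hp, mul_assoc]
      rcases lt_or_gt_of_ne hm with hlt | hlt
      · exact (((pow_dvd_pow Φ.p (by omega : Ψ.m ≤ Φ.m - 1)).mul_right c).mul_right b).mul_left _
      · have h1 : Φ.p ^ Φ.m * Φ.p ∣ Φ.p ^ Φ.m * a := by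
          rw [← pow_succ]
          exact (pow_dvd_pow Φ.p hlt).trans hu0
        have h2 : Φ.p ∣ a := (mul_dvd_mul_iff_left (pow_ne_zero _ Φ.irreducible.ne_zero)).1 h1
        obtain ⟨a', ha'⟩ := conj_dvd_of hΦ.map_p h2
        rw [ha', show Φ.p * a' * (Φ.p ^ (Φ.m - 1) * c * b) =
          (Φ.p ^ (Φ.m - 1) * Φ.p) * b * (a' * c) by ring, Φ.p_pow_mul_p]
        exact hw0.mul_right _
    · have hc : IsCoprime Φ.chi Ψ.chi :=
        (isCoprime_of_ne Φ.irreducible Ψ.irreducible Φ.monic Ψ.monic (Ne.symm hp)).pow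
      rw [eq_zero_of_coprime hu0 (aeval_eq_zero_of_mem_cyc hv.ann hu) hc]
      simp

theorem Decomp.exists_isLayerMap (H : IsPair ε A F) (hε : ε = 1)
    (hP : ∀ Φ : FrobeniusBlock K, Φ.HasPhiOne → Φ.IsPhiOne (P Φ))
    (hL : ∀ S ∈ L, S.Admissible ε) (hdec : Decomp P A F L U) (h : Φ.HasPhiOne) :
    ∃ ρ, IsLayerMap A F (P Φ) h U ((typeIIPolys L Φ).map (AdjoinRoot.mk Φ.p)) ρ := by
  induction L generalizing U with
  | nil =>
    have h0 : U = ⊥ := hdec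
    subst h0
    refine ⟨fun _ i => i.elim0, ⟨fun u hu => ?_, fun x => ⟨0, by simp, by simp, ?_⟩⟩⟩
    · intro v hv _ _ c
      rw [(Submodule.mem_bot K).1 hu]
      have h1 : diagForm (Φ.involution h) ((typeIIPolys [] Φ).map (AdjoinRoot.mk Φ.p))
          (fun i => i.elim0) (fun i => i.elim0) = 0 :=
        Finset.sum_eq_zero fun (i : Fin 0) _ => i.elim0
      rw [h1]
      simp
    · ext i
      exact i.elim0
  | cons S L ih =>
    obtain ⟨U₁, U₂, h1, h2, ho, rfl⟩ := hdec
    have hS := hL S (by simp)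
    have hd := (h1.nondegOn H hP hS).disjoint ho
    obtain ⟨ρ, hρ⟩ := ih (fun S hS => hL S (by simp [hS])) h2
    by_cases hne : ∃ f, S = .typeII Φ f
    · obtain ⟨f, rfl⟩ := hne
      obtain ⟨v, hv, rfl⟩ := h1
      obtain ⟨-, hΨ, hf, -, hdeg⟩ := hS
      have hann := hv.hasAnn ((hP Φ hΨ).chi_dvd_of_mul hf hdeg)
      rw [typeIIPolys_cons_self, List.map_cons]
      exact hρ.sup_cons H hv hann ho hd h2.invariant
    · push Not at hne
      have hpoly : typeIIPolys (S :: L) Φ = typeIIPolys L Φ := by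
        rcases S with Ψ | ⟨Ψ, f⟩
        · rfl
        · exact typeIIPolys_cons_of_ne _ _ fun h => hne f (by rw [h])
      rw [hpoly]
      exact hρ.sup_of_eq_zero H ho hd h1.invariant h2.invariant fun u hu w hw hu0 hw0 c =>
        h1.form_eq_zero H hε hP h hS hne hu hw hu0 hw0 c

theorem typeIIPolys_map_ne_zero (hL : ∀ S ∈ L, S.Admissible ε) :
    ∀ r ∈ (typeIIPolys L Φ).map (AdjoinRoot.mk Φ.p), r ≠ 0 := by
  intro r hr
  obtain ⟨f, hf, rfl⟩ := List.mem_map.1 hr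
  obtain ⟨-, -, hf0, -, hdeg⟩ := hL _ (mem_typeIIPolys.1 hf)
  exact fun h0 => hf0 (eq_zero_of_dvd_of_degree_lt (AdjoinRoot.mk_eq_zero.1 h0) hdeg)

theorem Decomp.diagFormEquiv (H : IsPair ε A F)
    (hP : ∀ Φ : FrobeniusBlock K, Φ.HasPhiOne → Φ.IsPhiOne (P Φ))
    (hL : ∀ S ∈ L, S.Admissible ε) (hL' : ∀ S ∈ L', S.Admissible ε) (hdec : Decomp P A F L U)
    (hdec' : Decomp P A F L' U) (h : Φ.HasPhiOne) : DiagFormEquiv (Φ.involution h)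
      ((typeIIPolys L Φ).map (AdjoinRoot.mk Φ.p)) ((typeIIPolys L' Φ).map (AdjoinRoot.mk Φ.p)) := by
  by_cases hε : ε = 1
  · obtain ⟨ρ, hρ⟩ := hdec.exists_isLayerMap H hε hP hL h
    obtain ⟨ρ', hρ'⟩ := hdec'.exists_isLayerMap H hε hP hL' h
    exact hρ.diagFormEquiv (hP Φ h) hdec.invariant (typeIIPolys_map_ne_zero hL)
      (typeIIPolys_map_ne_zero hL') hρ'
  · rw [typeIIPolys_eq_nil hL (Or.inl hε), typeIIPolys_eq_nil hL' (Or.inl hε)]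
    exact ⟨LinearEquiv.refl _ _, fun _ _ => rfl⟩

end Layers

/-! ### Replacement of summands -/

section Converse

variable {K : Type*} [Field K] [StarRing K] {V : Type*} [AddCommGroup V] [Module K V]
  {ε : K} {A : Module.End K V} {F : V →ₗ⋆[K] V →ₗ[K] K}
  {P : (Φ : FrobeniusBlock K) → Matrix (Fin Φ.size) (Fin Φ.size) K}
  {L L' : List (Summand K)} {U : Submodule K V} {Φ : FrobeniusBlock K}

/-- Splitting off a cyclic vector from a subspace with a given layer map. -/
theorem IsLayerMap.exists_cyclicVector [FiniteDimensional K V] (H : IsPair ε A F) (hε : ε = 1)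
    {M : Matrix (Fin Φ.size) (Fin Φ.size) K} (hM : Φ.IsPhiOne M) {h : Φ.HasPhiOne}
    (hU : ∀ x ∈ U, A x ∈ U) {f : K[X]} (hf0 : f ≠ 0)
    (hf : conj f = f) (hdeg : f.degree < Φ.p.degree) {a : List (AdjoinRoot Φ.p)}
    (ha : ∀ r ∈ a, r ≠ 0) {ρ : V → Fin (AdjoinRoot.mk Φ.p f :: a).length → AdjoinRoot Φ.p}
    (hρ : IsLayerMap A F M h U (AdjoinRoot.mk Φ.p f :: a) ρ) :
    ∃ w ∈ U, IsCyclicVector A F Φ (fun c => Φ.ell M (f * c)) w ∧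
      ∃ ρ', IsLayerMap A F M h (U ⊓ orth F (cyc A w)) a ρ' := by
  have := Φ.isDomain_adjoinRoot
  have hpf : ¬ Φ.p ∣ f := fun h0 => hf0 (eq_zero_of_dvd_of_degree_lt h0 hdeg)
  have hmk : AdjoinRoot.mk Φ.p f ≠ 0 := fun h0 => hpf (AdjoinRoot.mk_eq_zero.1 h0)
  have hne : ∀ r ∈ AdjoinRoot.mk Φ.p f :: a, r ≠ 0 := by
    intro r hr
    rcases List.mem_cons.1 hr with rfl | hr
    · exact hmk
    · exact ha r hr
  -- Lift the first coordinate vector, of norm f(ω), and normalize it to an exact cyclic vector w.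
  -- As w = b(A)u with b ≡ 1 modulo p, the vectors u and w have the same image under p(A)^(m-1).
  obtain ⟨u, hu, hu0, hρu⟩ := hρ.surj (Pi.single 0 1)
  have hform : ∀ t ∈ U, aeval A Φ.chi t = 0 → ∀ c, F u (aeval A (Φ.p ^ (Φ.m - 1) * c) t) =
      Φ.ellBar M (AdjoinRoot.mk Φ.p c * (AdjoinRoot.mk Φ.p f * ρ t 0)) := by
    intro t ht ht0 c
    rw [hρ.form u hu t ht hu0 ht0, hρu, diagForm_single_left]
    rfl
  obtain ⟨b, hb, hw⟩ := SelfadjointOperator.exists_cyclicVector H hε hM hu0 hf hpf fun c => by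
    rw [hform u hu hu0, hρu, Pi.single_eq_same, mul_one, ← map_mul (AdjoinRoot.mk Φ.p), Φ.ellBar_mk]
  have hwU : aeval A b u ∈ U := aeval_mem hU b u hu
  generalize hwdef : aeval A b u = w at hw hwU
  have hpp : conj (Φ.p ^ (Φ.m - 1)) = Φ.p ^ (Φ.m - 1) := by
    rw [conj, Polynomial.map_pow]
    exact congrArg (· ^ _) h.map_p
  have huw : aeval A (Φ.p ^ (Φ.m - 1)) u = aeval A (Φ.p ^ (Φ.m - 1)) w := by
    have h1 : aeval A (Φ.p ^ (Φ.m - 1) * (b - 1)) u = 0 := by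
      refine aeval_of_dvd hu0 ?_
      rw [← Φ.p_pow_mul_p]
      exact mul_dvd_mul_left _ hb
    rw [aeval_mul_apply, map_sub, LinearMap.sub_apply, hwdef, map_sub, map_one,
      Module.End.one_apply, sub_eq_zero] at h1
    exact h1.symm
  have hmove : ∀ (c : K[X]) (t : V), F u (aeval A (Φ.p ^ (Φ.m - 1) * c) t) =
      F w (aeval A (Φ.p ^ (Φ.m - 1) * c) t) := by
    intro c t
    rw [aeval_mul_apply, ← H.adj (Φ.p ^ (Φ.m - 1)) u, ← H.adj (Φ.p ^ (Φ.m - 1)) w, hpp, huw]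
  have hort : ∀ t ∈ orth F (cyc A w), ∀ c, F u (aeval A (Φ.p ^ (Φ.m - 1) * c) t) = 0 := by
    intro t ht c
    rw [hmove]
    exact aeval_mem (orth_invariant H (cyc_invariant A w)) _ t ht w (self_mem_cyc A w)
  have hzero : ∀ t ∈ U, aeval A Φ.chi t = 0 →
      (∀ c, F u (aeval A (Φ.p ^ (Φ.m - 1) * c) t) = 0) → ρ t 0 = 0 := by
    intro t ht ht0 h0
    have h1 : AdjoinRoot.mk Φ.p f * ρ t 0 = 0 := hM.eq_zero_of_ellBar fun c => by
      rw [← hform t ht ht0, h0]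
    exact (mul_eq_zero.1 h1).resolve_left hmk
  have hl := hM.chi_dvd_of_mul hf0 hdeg
  have hnd1 : NondegOn F (cyc A w) := fun x hx h0 => hw.nondeg H hl hx h0
  have hle : cyc A w ≤ U := cyc_le hU hwU
  refine ⟨w, hwU, hw, fun v i => ρ v i.succ, ⟨fun s hs t ht hs0 ht0 c => ?_, fun x => ?_⟩⟩
  · rw [hρ.form s hs.1 t ht.1 hs0 ht0, diagForm_cons, hzero t ht.1 ht0 (hort t ht.2), mul_zero,
      zero_add]
  · obtain ⟨t, ht, ht0, hρt⟩ := hρ.surj (Fin.cons 0 x)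
    obtain ⟨y, hy, hty⟩ := exists_sub_mem_orth hnd1 t
    obtain ⟨g, rfl⟩ := mem_cyc.1 hy
    have hy0 : aeval A Φ.chi (aeval A g w) = 0 := aeval_eq_zero_of_mem_cyc hw.ann hy
    have ht2U : t - aeval A g w ∈ U := U.sub_mem ht (hle hy)
    have ht20 : aeval A Φ.chi (t - aeval A g w) = 0 := by rw [map_sub, ht0, hy0, sub_zero]
    -- The first coordinate of t is zero, so its projection g(A)w to K[A]w has p dividing g. Such a
    -- vector lies in the radical, and subtracting it does not change `ρ`.
    have hpg : Φ.p ∣ g := by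
      have h1 : Φ.p ∣ f * g := hM.p_dvd fun c => by
        have h2 : F u (aeval A (Φ.p ^ (Φ.m - 1) * c) (aeval A g w)) = 0 := by
          have h3 := hort _ hty c
          rw [map_sub, map_sub, hform t ht ht0, hρt, Fin.cons_zero, mul_zero, mul_zero, map_zero,
            zero_sub, neg_eq_zero] at h3
          exact h3
        rw [hmove, ← aeval_mul_apply, hw.form] at h2
        rw [← h2]
        exact congrArg (Φ.ell M) (by ring)
      exact (Φ.irreducible.prime.dvd_or_dvd h1).resolve_left hpf
    have hkill : ∀ c : K[X], aeval A (Φ.p ^ (Φ.m - 1) * c) (aeval A g w) = 0 := by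
      intro c
      rw [← aeval_mul_apply]
      refine aeval_of_dvd hw.ann ?_
      rw [← Φ.p_pow_mul_p, mul_assoc]
      exact mul_dvd_mul_left _ (hpg.mul_left c)
    have heq : ρ (t - aeval A g w) = ρ t := by
      refine (hρ.eq_iff hM hne ht2U ht20 ht ht0).2 fun s _ _ c => ?_
      rw [map_sub (aeval A (Φ.p ^ (Φ.m - 1) * c)), hkill, sub_zero]
    refine ⟨t - aeval A g w, ⟨ht2U, hty⟩, ht20, ?_⟩
    ext i
    rw [heq, hρt, Fin.cons_succ]

/-- Each g in turn is realized by a cyclic vector and split off. The dimension hypothesis leaves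
nothing over when the list is exhausted. -/
theorem decomp_of_isLayerMap [FiniteDimensional K V] (H : IsPair ε A F)
    (hP : ∀ Φ : FrobeniusBlock K, Φ.HasPhiOne → Φ.IsPhiOne (P Φ)) (h : Φ.HasPhiOne) (gs : List K[X])
    (hgs : ∀ g ∈ gs, (Summand.typeII Φ g).Admissible ε) (hU : ∀ x ∈ U, A x ∈ U)
    (hfin : Module.finrank K U = gs.length * Φ.size)
    (hρ : ∃ ρ, IsLayerMap A F (P Φ) h U (gs.map (AdjoinRoot.mk Φ.p)) ρ) :
    Decomp P A F (gs.map (Summand.typeII Φ)) U := by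
  induction gs generalizing U with
  | nil =>
    rw [List.length_nil, zero_mul] at hfin
    exact Submodule.finrank_eq_zero.1 hfin
  | cons g gs ih =>
    obtain ⟨ρ, hρ⟩ := hρ
    obtain ⟨hε, -, hg0, hg, hdeg⟩ := hgs g (by simp)
    have hM := hP Φ h
    have hne : ∀ r ∈ gs.map (AdjoinRoot.mk Φ.p), r ≠ 0 := by
      intro r hr
      obtain ⟨f, hf, rfl⟩ := List.mem_map.1 hr
      obtain ⟨-, -, hf0, -, hfd⟩ := hgs f (by simp [hf])
      exact fun h0 => hf0 (eq_zero_of_dvd_of_degree_lt (AdjoinRoot.mk_eq_zero.1 h0) hfd)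
    obtain ⟨w, hwU, hw, hρ'⟩ := hρ.exists_cyclicVector H hε hM hU hg0 hg hdeg hne
    have hl := hM.chi_dvd_of_mul hg0 hdeg
    have hnd1 : NondegOn F (cyc A w) := fun x hx h0 => hw.nondeg H hl hx h0
    have hle : cyc A w ≤ U := cyc_le hU hwU
    have hf := finrank_inf_orth hnd1 hle
    rw [hfin, (hw.hasAnn hl).finrank_cyc_chi, List.length_cons, add_mul, one_mul] at hf
    exact ⟨cyc A w, U ⊓ orth F (cyc A w), ⟨w, hw, rfl⟩,
      ih (fun g hg => hgs g (by simp [hg]))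
        (fun x hx => ⟨hU x hx.1, orth_invariant H (cyc_invariant A w) x hx.2⟩) (by omega) hρ',
      fun x hx y hy => hy.2 x hx, (sup_orth_eq hnd1 hle).symm⟩

omit [StarRing K] in
theorem typeIIPolys_map_typeII (fs : List K[X]) : typeIIPolys (fs.map (Summand.typeII Φ)) Φ = fs := by
  induction fs with
  | nil => rfl
  | cons f fs ih => rw [List.map_cons, typeIIPolys_cons_self, ih]

/-- Replacing a group of summands of type (ii) with the same Frobenius block. -/
theorem Decomp.replace_group [FiniteDimensional K V] (H : IsPair ε A F)
    (hP : ∀ Φ : FrobeniusBlock K, Φ.HasPhiOne → Φ.IsPhiOne (P Φ)) (h : Φ.HasPhiOne)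
    {fs gs : List K[X]} (hfs : ∀ f ∈ fs, (Summand.typeII Φ f).Admissible ε)
    (hgs : ∀ g ∈ gs, (Summand.typeII Φ g).Admissible ε)
    (hfg : DiagFormEquiv (Φ.involution h) (fs.map (AdjoinRoot.mk Φ.p)) (gs.map (AdjoinRoot.mk Φ.p)))
    (hdec : Decomp P A F (fs.map (Summand.typeII Φ)) U) :
    Decomp P A F (gs.map (Summand.typeII Φ)) U := by
  have hlen : fs.length = gs.length := by
    have := Φ.isDomain_adjoinRoot
    obtain ⟨e, -⟩ := hfg
    have := e.finrank_eq
    simpa using this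
  have hadm : ∀ S ∈ fs.map (Summand.typeII Φ), S.Admissible ε := by
    intro S hS
    obtain ⟨f, hf, rfl⟩ := List.mem_map.1 hS
    exact hfs f hf
  rcases fs with _ | ⟨f, fs⟩
  · rcases gs with _ | ⟨g, gs⟩
    · exact hdec
    · simp at hlen
  have hε : ε = 1 := (hfs f (by simp)).1
  have hρ := hdec.exists_isLayerMap H hε hP hadm h
  rw [typeIIPolys_map_typeII] at hρ
  obtain ⟨ρ, hρ⟩ := hρ
  refine decomp_of_isLayerMap H hP h gs hgs hdec.invariant ?_ (hρ.of_diagFormEquiv hfg)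
  rw [hdec.finrank H hP hadm, ← hlen, List.map_map]
  have h1 : ∀ l : List K[X], (l.map ((fun S : Summand K => Fintype.card S.Index) ∘
      Summand.typeII Φ)).sum = l.length * Φ.size := by
    intro l
    induction l with
    | nil => simp
    | cons g l ih =>
      rw [List.map_cons, List.sum_cons, ih, List.length_cons, add_mul, one_mul, add_comm]
      congr 1
      exact Fintype.card_fin _
  exact h1 _

theorem Decomp.perm (H : IsPair ε A F) (hp : L.Perm L') (h : Decomp P A F L U) :
    Decomp P A F L' U := by
  induction hp generalizing U with
  | nil => exact h
  | cons S _ ih =>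
    obtain ⟨U₁, U₂, h1, h2, h3, h4⟩ := h
    exact ⟨U₁, U₂, h1, ih h2, h3, h4⟩
  | swap S T L =>
    obtain ⟨U₁, _, h1, ⟨U₂, U₃, h2, h3, ho', rfl⟩, ho, rfl⟩ := h
    refine ⟨U₂, U₁ ⊔ U₃, h2, ⟨U₁, U₃, h1, h3, fun x hx y hy =>
      ho x hx y (Submodule.mem_sup_right hy), rfl⟩, fun x hx y hy => ?_, sup_left_comm _ _ _⟩
    obtain ⟨y', hy', z, hz, rfl⟩ := Submodule.mem_sup.1 hy
    rw [map_add, ho' x hx z hz, H.eq_zero_symm (ho y' hy' x (Submodule.mem_sup_left hx)), add_zero]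
  | trans _ _ ih1 ih2 => exact ih2 (ih1 h)

theorem decomp_append : Decomp P A F (L ++ L') U ↔
    ∃ U₁ U₂, Decomp P A F L U₁ ∧ Decomp P A F L' U₂ ∧
      (∀ x ∈ U₁, ∀ y ∈ U₂, F x y = 0) ∧ U = U₁ ⊔ U₂ := by
  induction L generalizing U with
  | nil =>
    constructor
    · intro h
      exact ⟨⊥, U, rfl, h, fun x hx y _ => by rw [(Submodule.mem_bot K).1 hx]; simp, by simp⟩
    · rintro ⟨U₁, U₂, h1, h2, -, rfl⟩
      have h1 : U₁ = ⊥ := h1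
      rw [h1, bot_sup_eq]
      exact h2
  | cons S L ih =>
    constructor
    · rintro ⟨U₁, U', h1, h2, ho, rfl⟩
      obtain ⟨U₂, U₃, h2', h3, ho', rfl⟩ := ih.1 h2
      refine ⟨U₁ ⊔ U₂, U₃, ⟨U₁, U₂, h1, h2', fun x hx y hy =>
        ho x hx y (Submodule.mem_sup_left hy), rfl⟩, h3, fun x hx z hz => ?_, (sup_assoc _ _ _).symm⟩
      obtain ⟨x', hx', y, hy, rfl⟩ := Submodule.mem_sup.1 hx
      rw [map_add, LinearMap.add_apply, ho' y hy z hz, ho x' hx' z (Submodule.mem_sup_right hz),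
        add_zero]
    · rintro ⟨_, U₃, ⟨U₁, U₂, h1, h2, ho, rfl⟩, h3, ho', rfl⟩
      refine ⟨U₁, U₂ ⊔ U₃, h1, ih.2 ⟨U₂, U₃, h2, h3, fun x hx y hy =>
        ho' x (Submodule.mem_sup_right hx) y hy, rfl⟩, fun x hx y hy => ?_, sup_assoc _ _ _⟩
      obtain ⟨y', hy', z, hz, rfl⟩ := Submodule.mem_sup.1 hy
      rw [map_add, ho x hx y' hy', ho' x (Submodule.mem_sup_left hx) z hz, add_zero]

/-- Replacing both parts of a decomposition. -/
theorem Decomp.append_congr {L₁ L₂ L₁' L₂' : List (Summand K)}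
    (h1 : ∀ U : Submodule K V, Decomp P A F L₁ U → Decomp P A F L₁' U)
    (h2 : ∀ U : Submodule K V, Decomp P A F L₂ U → Decomp P A F L₂' U)
    (h : Decomp P A F (L₁ ++ L₂) U) : Decomp P A F (L₁' ++ L₂') U := by
  obtain ⟨U₁, U₂, hU₁, hU₂, ho, hU⟩ := decomp_append.1 h
  exact decomp_append.2 ⟨U₁, U₂, h1 _ hU₁, h2 _ hU₂, ho, hU⟩

/-- Replacing summands of type (i). -/
theorem Decomp.replace_typeI (H : IsPair ε A F) {B B' : List (FrobeniusBlock K)}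
    (hB : Multiset.Rel (fun Φ Ψ => Ψ.chi = Φ.chi ∨ Ψ.chi = Φ.chi.map (starRingEnd K))
      (B : Multiset (FrobeniusBlock K)) (B' : Multiset (FrobeniusBlock K)))
    (h : Decomp P A F (B.map Summand.typeI) U) : Decomp P A F (B'.map Summand.typeI) U := by
  induction B generalizing B' U with
  | nil =>
    have : B' = [] := by
      have := Multiset.rel_zero_left.1 hB
      simpa using this
    rw [this]
    exact h
  | cons Φ B ih =>
    rw [← Multiset.cons_coe] at hB
    obtain ⟨Ψ, t, hΨ, ht, hB'⟩ := Multiset.rel_cons_left.1 hB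
    obtain ⟨t, rfl⟩ := Quot.exists_rep t
    have hperm : B'.Perm (Ψ :: t) := Multiset.coe_eq_coe.1 hB'
    refine Decomp.perm H (hperm.map _).symm ?_
    obtain ⟨U₁, U₂, ⟨v, w, hvw, hU₁⟩, h2, ho, rfl⟩ := h
    refine ⟨U₁, U₂, ?_, ih ht h2, ho, rfl⟩
    rcases hΨ with hΨ | hΨ
    · rw [FrobeniusBlock.ext_chi hΨ]
      exact ⟨v, w, hvw, hU₁⟩
    -- Passing to the conjugate block keeps the subspace and exchanges its two generators.
    · rw [FrobeniusBlock.ext_chi (hΨ.trans Φ.chi_conj.symm)]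
      exact ⟨w, v, hvw.swap H, by rw [hU₁, sup_comm]⟩

theorem DiagFormEquiv.nil_left {R : Type*} [CommRing R] [Nontrivial R] {σ : R →+* R} {a : List R}
    (h : DiagFormEquiv σ [] a) : a = [] := by
  obtain ⟨e, -⟩ := h
  have := e.finrank_eq
  rw [Module.finrank_fin_fun, Module.finrank_fin_fun] at this
  exact List.length_eq_zero_iff.1 this.symm

omit [StarRing K] in
/-- The summands of type (ii) of a list can be collected by their Frobenius blocks. -/
theorem perm_group (L : List (Summand K)) (hL : ∀ Ψ, Summand.typeI Ψ ∉ L) (Φ : FrobeniusBlock K) :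
    ∃ L₀ : List (Summand K), L.Perm ((typeIIPolys L Φ).map (Summand.typeII Φ) ++ L₀) ∧
      typeIIPolys L₀ Φ = [] ∧ ∀ Ψ, Ψ ≠ Φ → typeIIPolys L₀ Ψ = typeIIPolys L Ψ := by
  induction L with
  | nil => exact ⟨[], by simp [typeIIPolys], rfl, fun _ _ => rfl⟩
  | cons S L ih =>
    obtain ⟨L₀, h1, h2, h3⟩ := ih fun Ψ h => hL Ψ (by simp [h])
    rcases S with Ψ | ⟨Ψ, f⟩
    · exact absurd (by simp) (hL Ψ)
    · by_cases hΨ : Ψ = Φ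
      · subst hΨ
        refine ⟨L₀, ?_, h2, fun Ω hΩ => ?_⟩
        · rw [typeIIPolys_cons_self]
          exact h1.cons _
        · rw [h3 Ω hΩ, typeIIPolys_cons_of_ne _ _ (Ne.symm hΩ)]
      · refine ⟨.typeII Ψ f :: L₀, ?_, ?_, fun Ω hΩ => ?_⟩
        · rw [typeIIPolys_cons_of_ne _ _ hΨ]
          exact (h1.cons _).trans List.perm_middle.symm
        · rw [typeIIPolys_cons_of_ne _ _ hΨ, h2]
        · by_cases hΩΨ : Ψ = Ω
          · subst hΩΨ
            rw [typeIIPolys_cons_self, typeIIPolys_cons_self, h3 _ hΩ]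
          · rw [typeIIPolys_cons_of_ne _ _ hΩΨ, typeIIPolys_cons_of_ne _ _ hΩΨ, h3 _ hΩ]

/-- Replacing summands of type (ii). -/
theorem Decomp.replace_typeII [FiniteDimensional K V] (H : IsPair ε A F)
    (hP : ∀ Φ : FrobeniusBlock K, Φ.HasPhiOne → Φ.IsPhiOne (P Φ))
    (hL : ∀ S ∈ L, S.Admissible ε) (hL' : ∀ S ∈ L', S.Admissible ε)
    (hI : ∀ Ψ, Summand.typeI Ψ ∉ L) (hI' : ∀ Ψ, Summand.typeI Ψ ∉ L')
    (hLL' : ∀ (Φ : FrobeniusBlock K) (h : Φ.HasPhiOne), DiagFormEquiv (Φ.involution h)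
      ((typeIIPolys L Φ).map (AdjoinRoot.mk Φ.p)) ((typeIIPolys L' Φ).map (AdjoinRoot.mk Φ.p)))
    (h : Decomp P A F L U) : Decomp P A F L' U := by
  induction hn : L.length using Nat.strong_induction_on generalizing L L' U with
  | _ n ih =>
    rcases L with _ | ⟨S, L⟩
    · have : L' = [] := by
        refine List.eq_nil_iff_forall_not_mem.2 fun S hS => ?_
        rcases S with Ψ | ⟨Ψ, f⟩
        · exact hI' Ψ hS
        · have hΨ := (hL' _ hS).2.1
          have := Ψ.isDomain_adjoinRoot
          have h1 := DiagFormEquiv.nil_left (hLL' Ψ hΨ)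
          have h2 := mem_typeIIPolys.2 hS
          rw [List.map_eq_nil_iff.1 h1] at h2
          simp at h2
      rw [this]
      exact h
    · rcases S with Ψ | ⟨Φ, f⟩
      · exact absurd (by simp) (hI Ψ)
      -- The whole group with the block of the first summand is replaced at once. It is nonempty, so
      -- the remaining list is shorter and the induction applies.
      · have hΦ := (hL _ (List.mem_cons_self)).2.1
        obtain ⟨L₀, hp, h0, hne⟩ := perm_group _ hI Φ
        obtain ⟨L₀', hp', h0', hne'⟩ := perm_group _ hI' Φ
        have hmem : ∀ S ∈ L₀, S ∈ Summand.typeII Φ f :: L := fun S hS =>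
          hp.symm.subset (List.mem_append_right _ hS)
        have hmem' : ∀ S ∈ L₀', S ∈ L' := fun S hS =>
          hp'.symm.subset (List.mem_append_right _ hS)
        have hlen := hp.length_eq
        simp only [typeIIPolys_cons_self, List.length_append, List.length_map, List.length_cons]
          at hlen hn
        refine Decomp.perm H hp'.symm (Decomp.append_congr (fun U' hU' => ?_) (fun U' hU' => ?_)
          (Decomp.perm H hp h))
        · exact hU'.replace_group H hP hΦ (fun g hg => hL _ (mem_typeIIPolys.1 hg))
            (fun g hg => hL' _ (mem_typeIIPolys.1 hg)) (hLL' Φ hΦ)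
        · refine ih L₀.length (by omega) (fun S hS => hL S (hmem S hS))
            (fun S hS => hL' S (hmem' S hS)) (fun Ψ hΨ => hI Ψ (hmem _ hΨ))
            (fun Ψ hΨ => hI' Ψ (hmem' _ hΨ)) (fun Ψ hΨ => ?_) hU' rfl
          by_cases hc : Ψ = Φ
          · subst hc
            rw [h0, h0']
            exact ⟨LinearEquiv.refl _ _, fun _ _ => rfl⟩
          · rw [hne Ψ hc, hne' Ψ hc]
            exact hLL' Ψ hΨ

omit [StarRing K] in
/-- Every list of summands is a permutation of a list of summands of type (i) followed by a list
of summands of type (ii). -/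
theorem perm_typeI_append (L : List (Summand K)) : ∃ (B : List (FrobeniusBlock K))
    (L₀ : List (Summand K)), L.Perm (B.map Summand.typeI ++ L₀) ∧
      (B : Multiset (FrobeniusBlock K)) = typeIBlocks L ∧ (∀ Ψ, Summand.typeI Ψ ∉ L₀) ∧
      ∀ Φ, typeIIPolys L₀ Φ = typeIIPolys L Φ := by
  induction L with
  | nil => exact ⟨[], [], by simp, rfl, by simp, fun _ => rfl⟩
  | cons S L ih =>
    obtain ⟨B, L₀, h1, h2, h3, h4⟩ := ih
    rcases S with Ψ | ⟨Ψ, f⟩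
    · refine ⟨Ψ :: B, L₀, h1.cons _, ?_, h3, h4⟩
      rw [typeIBlocks_cons_typeI, ← h2]
      rfl
    · refine ⟨B, .typeII Ψ f :: L₀, (h1.cons _).trans List.perm_middle.symm, h2, by simpa using h3,
        fun Φ => ?_⟩
      by_cases hΨ : Ψ = Φ
      · subst hΨ
        rw [typeIIPolys_cons_self, typeIIPolys_cons_self, h4]
      · rw [typeIIPolys_cons_of_ne _ _ hΨ, typeIIPolys_cons_of_ne _ _ hΨ, h4]

theorem Decomp.of_sameSummands [FiniteDimensional K V] (H : IsPair ε A F)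
    (hP : ∀ Φ : FrobeniusBlock K, Φ.HasPhiOne → Φ.IsPhiOne (P Φ))
    (hL : ∀ S ∈ L, S.Admissible ε) (hL' : ∀ S ∈ L', S.Admissible ε) (h : Decomp P A F L U)
    (hs : SameSummands L L') : Decomp P A F L' U := by
  obtain ⟨B, L₀, hp, hB, hI, hII⟩ := perm_typeI_append L
  obtain ⟨B', L₀', hp', hB', hI', hII'⟩ := perm_typeI_append L'
  refine Decomp.perm H hp'.symm (Decomp.append_congr (fun U' hU' => ?_) (fun U' hU' => ?_)
    (Decomp.perm H hp h))
  · refine Decomp.replace_typeI H ?_ hU'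
    rw [hB, hB']
    exact hs.1
  · refine Decomp.replace_typeII H hP
      (fun S hS => hL S (hp.symm.subset (List.mem_append_right _ hS)))
      (fun S hS => hL' S (hp'.symm.subset (List.mem_append_right _ hS))) hI hI'
      (fun Φ hΦ => ?_) hU'
    rw [hII, hII']
    exact hs.2 Φ hΦ

end Converse

end SelfadjointOperator

end

/-! ### The classification theorem -/

theorem theorem6 {K : Type*} [Field K] [StarRing K] (hchar : ringChar K ≠ 2)
    {V : Type*} [AddCommGroup V] [Module K V] [FiniteDimensional K V]
    (ε : K) (hε : ε = 1 ∨ ε = -1) (hinv : (∃ a : K, star a ≠ a) → ε = 1)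
    -- a choice of a matrix `Φ₁` for every Frobenius block `Φ` for which it exists
    (P : (Φ : SelfadjointOperator.FrobeniusBlock K) → Matrix (Fin Φ.size) (Fin Φ.size) K)
    (hP : ∀ Φ : SelfadjointOperator.FrobeniusBlock K, Φ.HasPhiOne → Φ.IsPhiOne (P Φ))
    (F : V →ₗ⋆[K] V →ₗ[K] K) (hF : ∀ x y, F x y = ε * star (F y x)) (hnd : F.Nondegenerate)
    (A : Module.End K V) (hA : ∀ x y, F x (A y) = F (A x) y) :
    (∃ L : List (SelfadjointOperator.Summand K),
      (∀ S ∈ L, S.Admissible ε) ∧ SelfadjointOperator.IsGivenBy P ε A F L) ∧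
    ∀ L L' : List (SelfadjointOperator.Summand K),
      (∀ S ∈ L, S.Admissible ε) → (∀ S ∈ L', S.Admissible ε) →
      SelfadjointOperator.IsGivenBy P ε A F L →
      (SelfadjointOperator.IsGivenBy P ε A F L' ↔ SelfadjointOperator.SameSummands L L') := by
  have H : SelfadjointOperator.IsPair ε A F := ⟨Ring.two_ne_zero hchar, hε, hinv, hF, hA⟩
  constructor
  · obtain ⟨L, hL, h⟩ := SelfadjointOperator.exists_decomp (P := P) H hP ⊤ (by simp)
      fun x _ h0 => hnd.2 x fun y => h0 y trivial
    exact ⟨L, hL, (SelfadjointOperator.isGivenBy_iff H hP hL).2 h⟩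
  · intro L L' hL hL' h
    rw [SelfadjointOperator.isGivenBy_iff H hP hL] at h
    rw [SelfadjointOperator.isGivenBy_iff H hP hL']
    exact ⟨fun h' => ⟨h.typeIBlocks_rel H hP hL hL' h', fun Φ hΦ =>
      h.diagFormEquiv H hP hL hL' h' hΦ⟩, fun hs => h.of_sameSummands H hP hL hL' hs⟩
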